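/- Write $\log$ for the natural logarithm. For a finite graph $G$ with vertex set $V$, a box (cube) representation of $G$ of dimension $k\ge 0$ is a family $I_1,\dots,I_k$ of interval graphs (unit interval graphs) on the vertex set $V$ such that $E(G)=E(I_1)\cap\dots\cap E(I_k)$, where the empty family ($k=0$) represents exactly the complete graph on $V$; an interval graph (unit interval graph) is the intersection graph of nonempty closed intervals (closed intervals of length $1$) of the real line. The boxicity $\operatorname{box}(G)$ (cubicity $\operatorname{cub}(G)$) is the least dimension of a box (cube) representation of $G$. There is a polynomial-time algorithm which, given a graph $G$ on $n$ vertices, computes a box representation $\mathcal B$ of $G$ (by listing the end points of all intervals) such that, if $n\ge 3$, $$|\mathcal B|\le 2\left\lceil \frac{n\sqrt{\log\log n}}{\sqrt{\log n}}\right\rceil \operatorname{box}(G).$$ Further, there is a polynomial-time algorithm which, given a graph $G$ on $n$ vertices, computes a cube representation $\mathcal C$ of $G$ (by listing the rational left end points of all unit intervals) such that, if $n\ge 3$, $$|\mathcal C|\le 2\left\lceil \frac{n(\log\log n)^{3/2}}{\sqrt{\log n}}\right\rceil \operatorname{cub}(G).$$ Here $|\cdot|$ denotes the dimension, and polynomial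 time means that the number of steps of a random access machine (unit cost, with addition and subtraction), given the adjacency matrix of $G$, is at most a polynomial in $n$. -/

import Mathlib

namespace Boxicity

section Graphs

variable {V : Type*}

/-- The intersection graph of the closed real intervals `[l v, r v]`, `v ∈ V`. -/
def intervalGraph (l r : V → ℝ) : SimpleGraph V where
  Adj u v := u ≠ v ∧ (Set.Icc (l u) (r u) ∩ Set.Icc (l v) (r v)).Nonempty
  symm := ⟨fun _ _ h => ⟨h.1.symm, by rw [Set.inter_comm]; exact h.2⟩⟩
  loopless := ⟨fun _ h => h.1 rfl⟩

/-- `I` is an interval graph: the intersection graph of nonempty closed intervals. -/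
def IsIntervalGraph (I : SimpleGraph V) : Prop :=
  ∃ l r : V → ℝ, (∀ v, l v ≤ r v) ∧ I = intervalGraph l r

/-- `I` is a unit interval graph: the intersection graph of closed intervals of length one. -/
def IsUnitIntervalGraph (I : SimpleGraph V) : Prop :=
  ∃ l : V → ℝ, I = intervalGraph l (fun v => l v + 1)

/-- `I₁, …, I_k` is a box representation of `G` of dimension `k`: each `I_i` is an interval graph
on the vertex set of `G` and `E(G) = E(I₁) ∩ ⋯ ∩ E(I_k)`. The empty family represents exactly the
complete graph. -/
def IsBoxRepresentation (G : SimpleGraph V) {k : ℕ} (I : Fin k → SimpleGraph V) : Prop :=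
  (∀ i, IsIntervalGraph (I i)) ∧ G = ⨅ i, I i

/-- As `IsBoxRepresentation`, with unit interval graphs. -/
def IsCubeRepresentation (G : SimpleGraph V) {k : ℕ} (I : Fin k → SimpleGraph V) : Prop :=
  (∀ i, IsUnitIntervalGraph (I i)) ∧ G = ⨅ i, I i

/-- The boxicity: the least dimension of a box representation (zero for complete graphs). -/
noncomputable def box (G : SimpleGraph V) : ℕ :=
  sInf {k | ∃ I : Fin k → SimpleGraph V, IsBoxRepresentation G I}

/-- The cubicity: the least dimension of a cube representation (zero for complete graphs). -/
noncomputable def cub (G : SimpleGraph V) : ℕ :=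
  sInf {k | ∃ I : Fin k → SimpleGraph V, IsCubeRepresentation G I}

end Graphs

/-!
### Random access machine

Structured programs for a unit-cost random access machine. The machine has integer variables and
integer arrays (a program mentions only finitely many of each, array cells are addressed
indirectly); its arithmetic is addition and truncated subtraction. There is no multiplication, so
numbers have at most linearly many bits in the number of steps, and polynomial time on this
machine is polynomial time on a Turing machine.
-/

/-- Contents of the variables and of the arrays. -/
structure State where
  /-- the value of variable `x` -/
  var : ℕ → ℕ
  /-- the value of cell `i` of array `a` -/
  arr : ℕ → ℕ → ℕ

/-- `x := m`. -/
def State.setVar (s : State) (x m : ℕ) : State :=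
  { s with var := Function.update s.var x m }

/-- `a[i] := m`. -/
def State.setArr (s : State) (a i m : ℕ) : State :=
  { s with arr := Function.update s.arr a (Function.update (s.arr a) i m) }

/-- Arithmetic expressions. -/
inductive Expr where
  | const (c : ℕ)
  | var (x : ℕ)
  | read (a : ℕ) (i : Expr)
  | add (e f : Expr)
  | sub (e f : Expr)

/-- The value of an expression. -/
def Expr.eval (s : State) : Expr → ℕ
  | const c => c
  | var x => s.var x
  | read a i => s.arr a (i.eval s)
  | add e f => e.eval s + f.eval s
  | sub e f => e.eval s - f.eval s

/-- The time to evaluate an expression: one step for every operation. -/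
def Expr.cost : Expr → ℕ
  | const _ => 1
  | var _ => 1
  | read _ i => i.cost + 1
  | add e f => e.cost + f.cost + 1
  | sub e f => e.cost + f.cost + 1

/-- Programs. A test counts as true if its value is not zero. -/
inductive Prog where
  /-- do nothing -/
  | skip
  /-- `x := e` -/
  | assign (x : ℕ) (e : Expr)
  /-- `a[i] := e` -/
  | write (a : ℕ) (i e : Expr)
  /-- `p; q` -/
  | seq (p q : Prog)
  /-- if `e` then `p` else `q` -/
  | cond (e : Expr) (p q : Prog)
  /-- while `e` do `p` -/
  | loop (e : Expr) (p : Prog)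

/-- `Exec p s s' t`: started in state `s`, the program `p` halts in state `s'` after exactly `t`
steps. -/
inductive Exec : Prog → State → State → ℕ → Prop where
  | skip (s : State) : Exec .skip s s 1
  | assign (x : ℕ) (e : Expr) (s : State) :
      Exec (.assign x e) s (s.setVar x (e.eval s)) (e.cost + 1)
  | write (a : ℕ) (i e : Expr) (s : State) :
      Exec (.write a i e) s (s.setArr a (i.eval s) (e.eval s)) (i.cost + e.cost + 1)
  | seq {p q : Prog} {s s' s'' : State} {t t' : ℕ} :
      Exec p s s' t → Exec q s' s'' t' → Exec (.seq p q) s s'' (t + t')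
  | cond_true {e : Expr} {p q : Prog} {s s' : State} {t : ℕ} :
      e.eval s ≠ 0 → Exec p s s' t → Exec (.cond e p q) s s' (e.cost + 1 + t)
  | cond_false {e : Expr} {p q : Prog} {s s' : State} {t : ℕ} :
      e.eval s = 0 → Exec q s s' t → Exec (.cond e p q) s s' (e.cost + 1 + t)
  | loop_true {e : Expr} {p : Prog} {s s' s'' : State} {t t' : ℕ} :
      e.eval s ≠ 0 → Exec p s s' t → Exec (.loop e p) s' s'' t' →
        Exec (.loop e p) s s'' (e.cost + 1 + t + t')
  | loop_false {e : Expr} {p : Prog} {s : State} :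
      e.eval s = 0 → Exec (.loop e p) s s (e.cost + 1)

open Classical in
/-- The input: variable `0` holds the number `n` of vertices, array `0` holds the adjacency matrix
row by row, and everything else is zero. -/
noncomputable def input {n : ℕ} (G : SimpleGraph (Fin n)) : State where
  var x := if x = 0 then n else 0
  arr a i := if a = 0 ∧ ∃ u v : Fin n, G.Adj u v ∧ i = u * n + v then 1 else 0

/-- The state `s` holds a box representation of `G` of dimension `d`: variable `0` holds `d`, and
cell `i * n + v` of array `1` (array `2`) holds the left (right) end point of the interval of the
vertex `v` in the `i`-th interval graph. -/
def HoldsBoxRepresentation {n : ℕ} (G : SimpleGraph (Fin n)) (s : State) (d : ℕ) : Prop :=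
  s.var 0 = d ∧
  (∀ (i : Fin d) (v : Fin n), s.arr 1 (i * n + v) ≤ s.arr 2 (i * n + v)) ∧
  IsBoxRepresentation G fun i : Fin d =>
    intervalGraph (fun v : Fin n => (s.arr 1 (i * n + v) : ℝ))
      (fun v : Fin n => (s.arr 2 (i * n + v) : ℝ))

/-- The state `s` holds a cube representation of `G` of dimension `d`: variable `0` holds `d`, and
the left end point of the unit interval of the vertex `v` in the `i`-th unit interval graph is the
rational number whose numerator is in cell `i * n + v` of array `1` and whose (positive)
denominator is in cell `i` of array `2`. -/
def HoldsCubeRepresentation {n : ℕ} (G : SimpleGraph (Fin n)) (s : State) (d : ℕ) : Prop :=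
  s.var 0 = d ∧
  (∀ i : Fin d, 0 < s.arr 2 i) ∧
  IsCubeRepresentation G fun i : Fin d =>
    intervalGraph (fun v : Fin n => (s.arr 1 (i * n + v) : ℝ) / (s.arr 2 i : ℝ))
      (fun v : Fin n => (s.arr 1 (i * n + v) : ℝ) / (s.arr 2 i : ℝ) + 1)

end Boxicity

/-! Cut the vertices into blocks of `k` consecutive ones, with `k` of order `√(log n / log log n)`.
For a single block, an interval graph of a box representation matters only through the order of at
most `2 * k` end points, so these may be taken in `{0, …, 2 * k}`. For at most `k` such families of
intervals there are at most `(2 * k + 1) ^ (2 * k * k) ≤ n ^ 8` possibilities, few enough to try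
them all.

A family on a block is extended to an outside vertex greedily, in two ways: from `0` up to the
largest left end point of a neighbour in the block (`upper`), or from the smallest right end point
of such a neighbour (`lower`) up to `2 * k + 1`. Edges survive, outside vertices meet each other,
and a non-neighbour in the block that some box representation separates from the outside vertex
stays separated on the same side. So an optimal box representation restricts to separating families
(`exists_separates_of_boxes`), and the least number `e` of families that serves every block is at
most `box G` (`numFamilies_le_box`). Conversely, `e` families per block give a box representation
with `2 * e` interval graphs per block (`adj_iff_boxes`).

For cubes, take `2 * k + 1` as the unit and split the vertices into two classes, one placed at
`upper`, the other at `2 * k + 1 + lower`. Vertices of one class always meet; vertices of different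
classes meet exactly if `lower ≤ upper`. Outside vertices have to be in one class, so the class is a
binary digit of a label which is constant outside the block. The digits tell each vertex of the
block from every other vertex (`adj_iff_cubes`); their number is the additional factor `O(log log
n)`, and `box G ≤ cub G`.

The estimates assume `log log n ≥ 100`. The finitely many smaller graphs are served by a table of
optimal representations, whose real end points are first made integral (`exists_scale`).

For the running time, `PC` is a class of polynomially bounded functions closed under arithmetic,
bounded recursion (`PC.rec`) and bounded search. Everything above lies in it, and
`exists_exec_output` turns its members into a program. -/

namespace Boxicity

/-! ### Polynomial-time functions on the machine -/

/-- A finite graph on an initial segment of the natural numbers. -/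
abbrev Dat := Σ n : ℕ, SimpleGraph (Fin n)

/-- Contexts: a graph together with finitely many numbers. -/
class Ctx (α : Type) where
  /-- how many numbers there are -/
  depth : ℕ
  /-- the graph -/
  dat : α → Dat
  /-- the numbers -/
  coord : α → ℕ → ℕ

open Ctx

instance : Ctx Dat where
  depth := 0
  dat a := a
  coord _ _ := 0

instance {α : Type} [Ctx α] : Ctx (α × ℕ) where
  depth := depth α + 1
  dat a := dat a.1
  coord a i := if i < depth α then coord a.1 i else a.2

variable {α : Type} [Ctx α]

/-- The number of vertices of the graph of a context. -/
def order (a : α) : ℕ := (dat a).1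

/-- The size of a context: the sum of the order of its graph and of its numbers. -/
def size (a : α) : ℕ := order a + ∑ i ∈ Finset.range (depth α), coord a i

@[simp] lemma dat_prod (x : α × ℕ) : dat x = dat x.1 := rfl

@[simp] lemma order_prod (x : α × ℕ) : order x = order x.1 := rfl

@[simp] lemma order_dat (x : Dat) : order x = x.1 := rfl

@[simp] lemma size_dat (x : Dat) : size x = x.1 := by
  change x.1 + ∑ i ∈ Finset.range 0, _ = _
  simp

@[simp] lemma size_prod (x : α × ℕ) : size x = size x.1 + x.2 := by
  change order x.1 + ∑ i ∈ Finset.range (depth α + 1), (if i < depth α then coord x.1 i else x.2)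
    = order x.1 + ∑ i ∈ Finset.range (depth α), coord x.1 i + x.2
  rw [Finset.sum_range_succ, if_neg (lt_irrefl _), add_assoc]
  congr 2
  exact Finset.sum_congr rfl fun i hi => if_pos (Finset.mem_range.1 hi)

lemma order_le_size (a : α) : order a ≤ size a := Nat.le_add_right _ _

/-- The state `s` holds the context `a`, whose `i`-th number is in variable `ρ i`. -/
structure Holds (a : α) (ρ : ℕ → ℕ) (s : State) : Prop where
  var_zero : s.var 0 = order a
  arr_zero : s.arr 0 = (input (dat a).2).arr 0
  var_coord : ∀ i < depth α, s.var (ρ i) = coord a i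

/-- `s'` agrees with `s` on all arrays and on the variables below `b`. -/
def Agree (b : ℕ) (s s' : State) : Prop := s'.arr = s.arr ∧ ∀ x < b, s'.var x = s.var x

lemma Agree.refl (b : ℕ) (s : State) : Agree b s s := ⟨rfl, fun _ _ => rfl⟩

lemma Agree.trans {b : ℕ} {s s' s'' : State} (h : Agree b s s') (h' : Agree b s' s'') :
    Agree b s s'' :=
  ⟨h'.1.trans h.1, fun x hx => (h'.2 x hx).trans (h.2 x hx)⟩

lemma Agree.mono {b c : ℕ} {s s' : State} (h : Agree c s s') (hb : b ≤ c) : Agree b s s' :=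
  ⟨h.1, fun x hx => h.2 x (hx.trans_le hb)⟩

lemma agree_setVar {b x : ℕ} (s : State) (m : ℕ) (h : b ≤ x) : Agree b s (s.setVar x m) :=
  ⟨rfl, fun y hy => Function.update_of_ne (by omega) _ _⟩

@[simp] lemma setVar_var_self (s : State) (x m : ℕ) : (s.setVar x m).var x = m :=
  Function.update_self _ _ _

lemma setVar_var_of_ne (s : State) {x y : ℕ} (m : ℕ) (h : y ≠ x) :
    (s.setVar x m).var y = s.var y :=
  Function.update_of_ne h _ _

/-- A layout which keeps the context below variable `b`. -/
def Below (α : Type) [Ctx α] (ρ : ℕ → ℕ) (b : ℕ) : Prop := 0 < b ∧ ∀ i < depth α, ρ i < b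

lemma Holds.agree {a : α} {ρ : ℕ → ℕ} {b : ℕ} {s s' : State} (h : Holds a ρ s)
    (hρ : Below α ρ b) (hs : Agree b s s') : Holds a ρ s' where
  var_zero := (hs.2 0 hρ.1).trans h.var_zero
  arr_zero := by rw [hs.1, h.arr_zero]
  var_coord i hi := (hs.2 _ (hρ.2 i hi)).trans (h.var_coord i hi)

lemma Below.mono {ρ : ℕ → ℕ} {b c : ℕ} (h : Below α ρ b) (hb : b ≤ c) : Below α ρ c :=
  ⟨h.1.trans_le hb, fun i hi => (h.2 i hi).trans_le hb⟩

lemma Holds.fst {x : α × ℕ} {ρ : ℕ → ℕ} {s : State} (h : Holds x ρ s) : Holds x.1 ρ s where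
  var_zero := h.var_zero
  arr_zero := h.arr_zero
  var_coord i hi := by
    rw [h.var_coord i (Nat.lt_succ_of_lt hi)]
    exact if_pos hi

lemma Holds.snd {x : α × ℕ} {ρ : ℕ → ℕ} {s : State} (h : Holds x ρ s) :
    s.var (ρ (depth α)) = x.2 := by
  rw [h.var_coord (depth α) (Nat.lt_succ_self _)]
  exact if_neg (lt_irrefl _)

lemma Below.fst {ρ : ℕ → ℕ} {b : ℕ} (h : Below (α × ℕ) ρ b) : Below α ρ b :=
  ⟨h.1, fun i hi => h.2 i (Nat.lt_succ_of_lt hi)⟩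

lemma Below.extend {ρ : ℕ → ℕ} {b c y : ℕ} (h : Below α ρ b) (hb : b ≤ c) (hy : y < c) :
    Below (α × ℕ) (Function.update ρ (depth α) y) c := by
  refine ⟨h.1.trans_le hb, fun i hi => ?_⟩
  rcases Nat.lt_succ_iff_lt_or_eq.1 hi with hi | rfl
  · rw [Function.update_of_ne hi.ne]
    exact (h.2 i hi).trans_le hb
  · rwa [Function.update_self]

lemma Holds.extend {a : α} {ρ : ℕ → ℕ} {s : State} (h : Holds a ρ s) {y m : ℕ}
    (hy : s.var y = m) : Holds (a, m) (Function.update ρ (depth α) y) s where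
  var_zero := h.var_zero
  arr_zero := h.arr_zero
  var_coord i hi := by
    change _ = if i < depth α then coord a i else m
    rcases Nat.lt_succ_iff_lt_or_eq.1 hi with hi | rfl
    · rw [Function.update_of_ne hi.ne, if_pos hi, h.var_coord i hi]
    · rw [Function.update_self, if_neg (lt_irrefl _), hy]

lemma polynomial_eval_mono (T : Polynomial ℕ) : Monotone fun x => T.eval x := by
  intro x y h
  simp only [Polynomial.eval_eq_sum, Polynomial.sum]
  gcongr

/-- `f` is bounded by a polynomial in the size of the context. -/
def PolyBounded (f : α → ℕ) : Prop := ∃ T : Polynomial ℕ, ∀ a, f a ≤ T.eval (size a)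

/-- Running `p` on contexts laid out by `ρ` puts `f` into variable `b` in time `T`, and changes
neither an array nor a variable below `b`. -/
def Computes (p : Prog) (ρ : ℕ → ℕ) (b : ℕ) (f : α → ℕ) (T : Polynomial ℕ) : Prop :=
  ∀ a s, Holds a ρ s → ∃ s' t, Exec p s s' t ∧ t ≤ T.eval (size a) ∧ Agree b s s' ∧ s'.var b = f a

/-- The function `f` is bounded by a polynomial and can be computed in polynomial time. -/
def PC (f : α → ℕ) : Prop :=
  PolyBounded f ∧ ∃ T : Polynomial ℕ, ∀ ρ b, Below α ρ b → ∃ p, Computes p ρ b f T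

lemma PolyBounded.add {f g : α → ℕ} (hf : PolyBounded f) (hg : PolyBounded g) :
    PolyBounded fun a => f a + g a := by
  obtain ⟨T, hT⟩ := hf
  obtain ⟨U, hU⟩ := hg
  exact ⟨T + U, fun a => by rw [Polynomial.eval_add]; exact add_le_add (hT a) (hU a)⟩

lemma PolyBounded.mul {f g : α → ℕ} (hf : PolyBounded f) (hg : PolyBounded g) :
    PolyBounded fun a => f a * g a := by
  obtain ⟨T, hT⟩ := hf
  obtain ⟨U, hU⟩ := hg
  exact ⟨T * U, fun a => by rw [Polynomial.eval_mul]; exact Nat.mul_le_mul (hT a) (hU a)⟩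

lemma PolyBounded.mono {f g : α → ℕ} (hg : PolyBounded g) (h : ∀ a, f a ≤ g a) :
    PolyBounded f :=
  hg.imp fun _ hT a => (h a).trans (hT a)

lemma polyBounded_const (c : ℕ) : PolyBounded fun _ : α => c :=
  ⟨Polynomial.C c, fun a => by simp⟩

lemma polyBounded_size : PolyBounded fun a : α => size a :=
  ⟨Polynomial.X, fun a => by simp⟩

lemma PolyBounded.eval {f : α → ℕ} (hf : PolyBounded f) (T : Polynomial ℕ) :
    PolyBounded fun a => T.eval (f a) := by
  obtain ⟨U, hU⟩ := hf
  exact ⟨T.comp U, fun a => by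
    rw [Polynomial.eval_comp]; exact polynomial_eval_mono T (hU a)⟩

lemma pc_of_expr {f : α → ℕ} (hf : PolyBounded f) (c : ℕ) (e : (ℕ → ℕ) → Expr)
    (hc : ∀ ρ, (e ρ).cost = c)
    (he : ∀ (a : α) ρ s, Holds a ρ s → (e ρ).eval s = f a) : PC f := by
  refine ⟨hf, Polynomial.C (c + 1), fun ρ b _ => ⟨.assign b (e ρ), fun a s hs =>
    ⟨_, _, .assign b (e ρ) s, ?_, agree_setVar _ _ le_rfl, ?_⟩⟩⟩
  · simp [hc]
  · rw [setVar_var_self, he a ρ s hs]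

lemma PC.const (c : ℕ) : PC fun _ : α => c :=
  pc_of_expr (polyBounded_const c) 1 (fun _ => .const c) (fun _ => rfl) fun _ _ _ _ => rfl

lemma pc_order : PC fun a : α => order a :=
  pc_of_expr (polyBounded_size.mono order_le_size) 1 (fun _ => .var 0) (fun _ => rfl)
    fun _ _ _ h => h.var_zero

lemma PC.snd : PC fun x : α × ℕ => x.2 :=
  pc_of_expr (polyBounded_size.mono fun x => by simp) 1 (fun ρ => .var (ρ (depth α)))
    (fun _ => rfl) fun _ _ _ h => h.snd

/-- A layout of the pair is also a layout of its first component, so the program is unchanged. This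
is why `PC` asks for programs for all layouts, with one common time bound. -/
lemma PC.fst {f : α → ℕ} (hf : PC f) : PC fun x : α × ℕ => f x.1 := by
  obtain ⟨⟨U, hU⟩, T, hT⟩ := hf
  refine ⟨⟨U, fun x => (hU x.1).trans (polynomial_eval_mono U (by simp))⟩, T, fun ρ b hρ => ?_⟩
  obtain ⟨p, hp⟩ := hT ρ b hρ.fst
  refine ⟨p, fun x s hs => ?_⟩
  obtain ⟨s', t, h, ht, h'⟩ := hp x.1 s hs.fst
  exact ⟨s', t, h, ht.trans (polynomial_eval_mono T (by simp)), h'⟩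

/-- Combine the values of two computable functions by an expression. -/
lemma PC.binary {f g h : α → ℕ} (hf : PC f) (hg : PC g) (hh : PolyBounded h) (c : ℕ)
    (e : ℕ → Expr) (hc : ∀ b, (e b).cost = c)
    (he : ∀ a b s, s.var b = f a → s.var (b + 1) = g a → s.arr 0 = (input (dat a).2).arr 0 →
      (e b).eval s = h a) : PC h := by
  obtain ⟨-, T, hT⟩ := hf
  obtain ⟨-, U, hU⟩ := hg
  refine ⟨hh, T + U + Polynomial.C (c + 1), fun ρ b hρ => ?_⟩
  obtain ⟨p, hp⟩ := hT ρ b hρ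
  -- The second program works from `b + 1` on, so the first value survives in variable `b`.
  obtain ⟨q, hq⟩ := hU ρ (b + 1) (hρ.mono (Nat.le_succ b))
  refine ⟨.seq p (.seq q (.assign b (e b))), fun a s hs => ?_⟩
  obtain ⟨s₁, t₁, h₁, ht₁, ha₁, hv₁⟩ := hp a s hs
  obtain ⟨s₂, t₂, h₂, ht₂, ha₂, hv₂⟩ := hq a s₁ (hs.agree hρ ha₁)
  have ha := ha₁.trans (ha₂.mono (Nat.le_succ b))
  refine ⟨_, _, .seq h₁ (.seq h₂ (.assign b (e b) s₂)), ?_,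
    ha.trans (agree_setVar _ _ le_rfl), ?_⟩
  · simp only [Polynomial.eval_add, Polynomial.eval_C, hc]
    omega
  · rw [setVar_var_self]
    exact he a b s₂ ((ha₂.2 b (Nat.lt_succ_self b)).trans hv₁) hv₂ (hs.agree hρ ha).arr_zero

lemma PC.add {f g : α → ℕ} (hf : PC f) (hg : PC g) : PC fun a => f a + g a :=
  hf.binary hg (hf.1.add hg.1) 3 (fun b => .add (.var b) (.var (b + 1))) (fun _ => rfl)
    fun a b s h₁ h₂ _ => by simp [Expr.eval, h₁, h₂]

lemma PC.sub {f g : α → ℕ} (hf : PC f) (hg : PC g) : PC fun a => f a - g a :=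
  hf.binary hg (hf.1.mono fun _ => Nat.sub_le _ _) 3 (fun b => .sub (.var b) (.var (b + 1)))
    (fun _ => rfl) fun a b s h₁ h₂ _ => by simp [Expr.eval, h₁, h₂]

lemma pc_input {f : α → ℕ} (hf : PC f) : PC fun a => (input (dat a).2).arr 0 (f a) := by
  refine hf.binary hf ((polyBounded_const 1).mono fun a => ?_) 2 (fun b => .read 0 (.var b))
    (fun _ => rfl) fun a b s h₁ _ h₂ => by simp [Expr.eval, h₁, h₂]
  simp only [input]
  split_ifs <;> simp

/-- Correctness of the loop that carries out a bounded recursion: the value is in variable `b`, the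
index in `b + 1`, and the number of rounds in `b + 2`. -/
lemma exec_rec {x₀ m : α → ℕ} {g : (α × ℕ) × ℕ → ℕ} {p : Prog} {ρ : ℕ → ℕ} {b c : ℕ}
    {T : Polynomial ℕ} (hρ : Below α ρ b)
    (hp : Computes p (Function.update (Function.update ρ (depth α) (b + 1)) (depth α + 1) b)
      (b + 3) g T) (a : α)
    (hc : ∀ i < m a, T.eval (size a + i +
      (Nat.rec (x₀ a) (fun i r => g ((a, i), r)) i : ℕ)) ≤ c) :
    ∀ (j i : ℕ), i + j = m a → ∀ s, Holds a ρ s →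
      s.var b = Nat.rec (x₀ a) (fun i r => g ((a, i), r)) i → s.var (b + 1) = i →
      s.var (b + 2) = m a →
      ∃ s' t, Exec (.loop (.sub (.var (b + 2)) (.var (b + 1))) (.seq p (.seq
        (.assign b (.var (b + 3))) (.assign (b + 1) (.add (.var (b + 1)) (.const 1)))))) s s' t ∧
        t ≤ j * (c + 10) + 4 ∧ Agree b s s' ∧
        s'.var b = Nat.rec (x₀ a) (fun i r => g ((a, i), r)) (m a) := by
  intro j
  induction j with
  | zero =>
    intro i hi s hs hb hb1 hb2
    obtain rfl : i = m a := by omega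
    exact ⟨s, _, .loop_false (by simp [Expr.eval, hb1, hb2]), by simp [Expr.cost],
      Agree.refl _ _, hb⟩
  | succ j ih =>
    intro i hi s hs hb hb1 hb2
    obtain ⟨s₁, t₁, h₁, ht₁, ha₁, hv₁⟩ := hp ((a, i), _) s ((hs.extend hb1).extend hb)
    have hs₂ : Agree b s₁ (s₁.setVar b (s₁.var (b + 3))) := agree_setVar _ _ le_rfl
    set s₂ := s₁.setVar b (s₁.var (b + 3)) with hs₂'
    have hs₃ : Agree b s₂ (s₂.setVar (b + 1) (s₂.var (b + 1) + 1)) :=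
      agree_setVar _ _ (Nat.le_succ b)
    have ha := ((ha₁.mono (by omega)).trans hs₂).trans hs₃
    have e1 : s₂.var (b + 1) = i := by
      rw [hs₂', setVar_var_of_ne _ _ (by omega), ha₁.2 _ (by omega), hb1]
    obtain ⟨s', t, h, ht, ha', hv⟩ := ih (i + 1) (by omega)
      (s₂.setVar (b + 1) (s₂.var (b + 1) + 1)) (hs.agree hρ ha)
      (by rw [setVar_var_of_ne _ _ (by omega), hs₂', setVar_var_self, hv₁])
      (by rw [setVar_var_self, e1])
      (by rw [setVar_var_of_ne _ _ (by omega), hs₂', setVar_var_of_ne _ _ (by omega),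
        ha₁.2 _ (by omega), hb2])
    refine ⟨s', _, .loop_true ?_ (.seq h₁ (.seq (.assign b (.var (b + 3)) s₁)
      (.assign (b + 1) (.add (.var (b + 1)) (.const 1)) _))) h, ?_, ha.trans ha', hv⟩
    · simp only [Expr.eval, hb1, hb2]
      omega
    · have := hc i (by omega)
      simp only [size_prod] at ht₁
      simp only [Expr.cost]
      have e : (j + 1) * (c + 10) = j * (c + 10) + (c + 10) := by ring
      rw [e]
      omega

/-- A round takes time polynomial in a size that includes the accumulator. The bound `B` on all
intermediate values excludes growth such as that of repeated squaring. -/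
lemma PC.rec {x₀ m : α → ℕ} {g : (α × ℕ) × ℕ → ℕ} (hx : PC x₀) (hm : PC m) (hg : PC g)
    {B : α → ℕ} (hB : PolyBounded B)
    (hb : ∀ a i, i ≤ m a → (Nat.rec (x₀ a) (fun i r => g ((a, i), r)) i : ℕ) ≤ B a) :
    PC fun a => (Nat.rec (x₀ a) (fun i r => g ((a, i), r)) (m a) : ℕ) := by
  obtain ⟨-, T, hT⟩ := hx
  obtain ⟨hmb, U, hU⟩ := hm
  obtain ⟨-, S, hS⟩ := hg
  have hCb : PolyBounded fun a : α => S.eval (size a + m a + B a) :=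
    ((polyBounded_size.add hmb).add hB).eval S
  obtain ⟨W, hW⟩ := (hmb.mul (hCb.add (polyBounded_const 10))).add (polyBounded_const 10)
  refine ⟨hB.mono fun a => hb a _ le_rfl, T + U + W, fun ρ b hρ => ?_⟩
  obtain ⟨p, hp⟩ := hT ρ b hρ
  obtain ⟨q, hq⟩ := hU ρ (b + 2) (hρ.mono (by omega))
  obtain ⟨r, hr⟩ := hS (Function.update (Function.update ρ (depth α) (b + 1)) (depth α + 1) b)
    (b + 3) (Below.extend (α := α × ℕ)
      (Below.extend hρ (Nat.le_add_right b 3) (by omega)) le_rfl (by omega))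
  refine ⟨.seq p (.seq q (.seq (.assign (b + 1) (.const 0)) (.loop (.sub (.var (b + 2))
    (.var (b + 1))) (.seq r (.seq (.assign b (.var (b + 3)))
    (.assign (b + 1) (.add (.var (b + 1)) (.const 1)))))))), fun a s hs => ?_⟩
  obtain ⟨s₁, t₁, h₁, ht₁, ha₁, hv₁⟩ := hp a s hs
  obtain ⟨s₂, t₂, h₂, ht₂, ha₂, hv₂⟩ := hq a s₁ (hs.agree hρ ha₁)
  have ha := (ha₁.trans (ha₂.mono (by omega))).trans
    (agree_setVar (b := b) (x := b + 1) s₂ 0 (by omega))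
  obtain ⟨s', t, h, ht, ha', hv⟩ := exec_rec (x₀ := x₀) (m := m) (g := g) hρ hr a
    (c := S.eval (size a + m a + B a))
    (fun i hi => polynomial_eval_mono S (by have := hb a i hi.le; omega)) (m a) 0 (by omega)
    (s₂.setVar (b + 1) 0) (hs.agree hρ ha)
    (by rw [setVar_var_of_ne _ _ (by omega), ha₂.2 _ (by omega), hv₁]; rfl) (by simp)
    (by rw [setVar_var_of_ne _ _ (by omega), hv₂])
  refine ⟨s', _, .seq h₁ (.seq h₂ (.seq (.assign (b + 1) (.const 0) s₂) h)), ?_,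
    ha.trans ha', hv⟩
  have := hW a
  beta_reduce at this
  simp only [Polynomial.eval_add, Expr.cost]
  omega

end Boxicity

/-! ### Closure properties: arithmetic, decidable predicates, bounded search -/

namespace Boxicity

open Ctx

variable {α : Type} [Ctx α]

lemma PC.congr {f g : α → ℕ} (hf : PC f) (h : ∀ a, f a = g a) : PC g := by
  rwa [← funext h]

/-- Repeated addition is fast enough, because the number of rounds `f a` is polynomially bounded. -/
lemma PC.mul {f g : α → ℕ} (hf : PC f) (hg : PC g) : PC fun a => f a * g a := by
  have key : ∀ a i, (Nat.rec 0 (fun _ r => r + g a) i : ℕ) = i * g a := by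
    intro a i
    induction i with
    | zero => simp
    | succ i ih => simp only [ih]; ring
  refine (PC.rec (PC.const 0) hf (PC.snd.add hg.fst.fst) (hf.1.mul hg.1) fun a i hi => ?_).congr
    fun a => key a (f a)
  exact (key a i).trans_le (Nat.mul_le_mul_right _ hi)

lemma PC.sum {m : α → ℕ} {f : α → ℕ → ℕ} (hm : PC m) (hf : PC fun x : α × ℕ => f x.1 x.2) :
    PC fun a => ∑ i ∈ Finset.range (m a), f a i := by
  have key : ∀ a i, (Nat.rec 0 (fun i r => r + f a i) i : ℕ) = ∑ j ∈ Finset.range i, f a j := by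
    intro a i
    induction i with
    | zero => simp
    | succ i ih => simp only [ih, Finset.sum_range_succ]
  obtain ⟨U, hU⟩ := hf.1
  refine (PC.rec (PC.const 0) hm (PC.snd.add hf.fst)
    (hm.1.mul ((polyBounded_size.add hm.1).eval U)) fun a i hi => ?_).congr fun a => key a (m a)
  refine (key a i).trans_le ((Finset.sum_le_card_nsmul _ _ (U.eval (size a + m a))
    fun j hj => ?_).trans ?_)
  · have hj := Finset.mem_range.1 hj
    exact (hU (a, j)).trans (polynomial_eval_mono U (by simp only [size_prod]; omega))
  · simp only [Finset.card_range, smul_eq_mul]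
    exact Nat.mul_le_mul_right _ hi

open Classical in
/-- The predicate `P` can be decided in polynomial time. -/
def PCP (P : α → Prop) : Prop := PC fun a => if P a then 1 else 0

lemma PCP.congr {P Q : α → Prop} (hP : PCP P) (h : ∀ a, P a ↔ Q a) : PCP Q := by
  rwa [← funext fun a => propext (h a)]

lemma pcp_of_ne_zero {f : α → ℕ} (hf : PC f) : PCP fun a => f a ≠ 0 := by
  refine ((PC.const 1).sub ((PC.const 1).sub hf)).congr fun a => ?_
  by_cases h : f a = 0
  · simp [h]
  · rw [if_pos h]
    omega

lemma PCP.not {P : α → Prop} (hP : PCP P) : PCP fun a => ¬ P a := by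
  refine ((PC.const 1).sub hP).congr fun a => ?_
  by_cases h : P a <;> simp [h]

lemma PCP.and {P Q : α → Prop} (hP : PCP P) (hQ : PCP Q) : PCP fun a => P a ∧ Q a := by
  refine (PC.mul hP hQ).congr fun a => ?_
  by_cases h : P a <;> by_cases h' : Q a <;> simp [h, h']

lemma PCP.or {P Q : α → Prop} (hP : PCP P) (hQ : PCP Q) : PCP fun a => P a ∨ Q a :=
  (hP.not.and hQ.not).not.congr fun a => by tauto

lemma PCP.imp {P Q : α → Prop} (hP : PCP P) (hQ : PCP Q) : PCP fun a => P a → Q a :=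
  (hP.not.or hQ).congr fun a => by tauto

lemma PC.lt {f g : α → ℕ} (hf : PC f) (hg : PC g) : PCP fun a => f a < g a :=
  (pcp_of_ne_zero (hg.sub hf)).congr fun a => by omega

lemma PC.le {f g : α → ℕ} (hf : PC f) (hg : PC g) : PCP fun a => f a ≤ g a :=
  (hg.lt hf).not.congr fun a => by omega

lemma PC.eq {f g : α → ℕ} (hf : PC f) (hg : PC g) : PCP fun a => f a = g a :=
  ((hf.le hg).and (hg.le hf)).congr fun a => by omega

lemma PC.ne {f g : α → ℕ} (hf : PC f) (hg : PC g) : PCP fun a => f a ≠ g a :=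
  (hf.eq hg).not

lemma PC.ite {P : α → Prop} [DecidablePred P] {f g : α → ℕ} (hP : PCP P) (hf : PC f) (hg : PC g) :
    PC fun a => if P a then f a else g a := by
  refine ((PC.mul hP hf).add ((PC.const 1).sub hP |>.mul hg)).congr fun a => ?_
  by_cases h : P a <;> simp [h]

lemma PCP.exists_lt {m : α → ℕ} {P : α → ℕ → Prop} (hm : PC m)
    (hP : PCP fun x : α × ℕ => P x.1 x.2) : PCP fun a => ∃ i < m a, P a i := by
  classical
  refine (pcp_of_ne_zero (PC.sum (f := fun a i => if P a i then 1 else 0) hm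
    (PC.ite hP (PC.const 1) (PC.const 0)))).congr fun a => ?_
  simp

lemma PCP.forall_lt {m : α → ℕ} {P : α → ℕ → Prop} (hm : PC m)
    (hP : PCP fun x : α × ℕ => P x.1 x.2) : PCP fun a => ∀ i < m a, P a i :=
  (PCP.exists_lt (P := fun a i => ¬ P a i) hm hP.not).not.congr fun a => by
    push Not; rfl

lemma PC.minimum {f g : α → ℕ} (hf : PC f) (hg : PC g) : PC fun a => min (f a) (g a) :=
  (hf.sub (hf.sub hg)).congr fun a => by omega

lemma PC.maximum {f g : α → ℕ} (hf : PC f) (hg : PC g) : PC fun a => max (f a) (g a) :=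
  (hf.add (hg.sub hf)).congr fun a => by omega

lemma PC.sup {m : α → ℕ} {f : α → ℕ → ℕ} (hm : PC m) (hf : PC fun x : α × ℕ => f x.1 x.2) :
    PC fun a => (Finset.range (m a)).sup (f a) := by
  have key : ∀ a i, (Nat.rec 0 (fun i r => max r (f a i)) i : ℕ) = (Finset.range i).sup (f a) := by
    intro a i
    induction i with
    | zero => simp
    | succ i ih => simp only [ih, Finset.range_add_one, Finset.sup_insert]; exact max_comm _ _
  obtain ⟨U, hU⟩ := hf.1
  refine (PC.rec (PC.const 0) hm (PC.snd.maximum hf.fst)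
    ((polyBounded_size.add hm.1).eval U) fun a i hi => ?_).congr fun a => key a (m a)
  refine (key a i).trans_le (Finset.sup_le fun j hj => ?_)
  have hj := Finset.mem_range.1 hj
  exact (hU (a, j)).trans (polynomial_eval_mono U (by simp only [size_prod]; omega))

/-- A supremum in which failing `i` count as `0`, the default value of `Nat.findGreatest`. -/
lemma PC.findGreatest {m : α → ℕ} {P : α → ℕ → Prop} [∀ a, DecidablePred (P a)] (hm : PC m)
    (hP : PCP fun x : α × ℕ => P x.1 x.2) : PC fun a => Nat.findGreatest (P a) (m a) := by
  refine (PC.sup (f := fun a i => if P a i then i else 0) (hm.add (PC.const 1))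
    (PC.ite hP PC.snd (PC.const 0))).congr fun a => ?_
  induction m a with
  | zero => simp
  | succ i ih =>
    rw [Finset.range_add_one, Finset.sup_insert, ih, Nat.findGreatest_succ]
    split_ifs with h
    · exact max_eq_left ((Nat.findGreatest_le i).trans (Nat.le_succ i))
    · simp

/-- The map `π` forgets some of the numbers of a context. -/
def CtxMap {β : Type} [Ctx β] (π : β → α) : Prop :=
  (∀ b, dat (π b) = dat b) ∧
    ∃ σ : ℕ → ℕ, ∀ i < depth α, σ i < depth β ∧ ∀ b, coord (π b) i = coord b (σ i)

lemma CtxMap.id : CtxMap fun a : α => a :=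
  ⟨fun _ => rfl, fun i => i, fun _ hi => ⟨hi, fun _ => rfl⟩⟩

lemma CtxMap.fst {β : Type} [Ctx β] {π : β → α} (h : CtxMap π) :
    CtxMap fun x : β × ℕ => π x.1 := by
  obtain ⟨h, σ, hσ⟩ := h
  exact ⟨fun x => h x.1, σ, fun i hi => ⟨Nat.lt_succ_of_lt (hσ i hi).1,
    fun x => ((hσ i hi).2 x.1).trans (if_pos (hσ i hi).1).symm⟩⟩

/-- Several numbers of `π b` may come from the same number of `b`, hence the factor. -/
lemma CtxMap.size_le {β : Type} [Ctx β] {π : β → α} (h : CtxMap π) (b : β) :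
    size (π b) ≤ (depth α + 1) * size b := by
  obtain ⟨h, σ, hσ⟩ := h
  have h₁ : order (π b) ≤ size b := by
    rw [order, h b]
    exact order_le_size b
  have h₂ : ∑ i ∈ Finset.range (depth α), coord (π b) i ≤ depth α * size b := by
    refine (Finset.sum_le_card_nsmul _ _ (size b) fun i hi => ?_).trans (by simp)
    obtain ⟨hi, hc⟩ := hσ i (Finset.mem_range.1 hi)
    rw [hc]
    exact (Finset.single_le_sum (fun _ _ => Nat.zero_le _) (Finset.mem_range.2 hi)).trans
      (Nat.le_add_left _ _)
  rw [size]
  linarith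

/-- Composition in the last number, with unneeded numbers of the context dropped. Forgetting them
costs nothing: the layout `ρ ∘ σ` finds the remaining ones where they are. -/
lemma PC.subst {β : Type} [Ctx β] {π : β → α} (hπ : CtxMap π) {f : α × ℕ → ℕ} {g : β → ℕ}
    (hf : PC f) (hg : PC g) : PC fun b => f (π b, g b) := by
  obtain ⟨⟨V, hV⟩, T, hT⟩ := hf
  obtain ⟨hgb, U, hU⟩ := hg
  have hs : ∀ b, size (π b, g b) ≤ (depth α + 1) * size b + g b := fun b => by
    rw [size_prod]
    exact Nat.add_le_add_right (hπ.size_le b) _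
  have hsb : PolyBounded fun b : β => (depth α + 1) * size b + g b :=
    ((polyBounded_const _).mul polyBounded_size).add hgb
  obtain ⟨W, hW⟩ := (hsb.eval T).add (polyBounded_const 10)
  refine ⟨(hsb.eval V).mono fun b => (hV _).trans (polynomial_eval_mono V (hs b)), U + W,
    fun ρ b hρ => ?_⟩
  obtain ⟨hd, σ, hσ⟩ := hπ
  have hρ' : Below α (fun i => ρ (σ i)) b := ⟨hρ.1, fun i hi => hρ.2 _ (hσ i hi).1⟩
  obtain ⟨q, hq⟩ := hU ρ b hρ
  obtain ⟨p, hp⟩ := hT _ (b + 1) (hρ'.extend (Nat.le_succ b) (Nat.lt_succ_self b))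
  refine ⟨.seq q (.seq p (.assign b (.var (b + 1)))), fun a s h => ?_⟩
  obtain ⟨s₁, t₁, h₁, ht₁, ha₁, hv₁⟩ := hq a s h
  have h' := h.agree hρ ha₁
  have h'' : Holds (π a) (fun i => ρ (σ i)) s₁ :=
    ⟨by rw [h'.var_zero, order, order, hd], by rw [h'.arr_zero, hd], fun i hi => by
      rw [h'.var_coord _ (hσ i hi).1, (hσ i hi).2]⟩
  obtain ⟨s₂, t₂, h₂, ht₂, ha₂, hv₂⟩ := hp _ s₁ (h''.extend hv₁)
  refine ⟨_, _, .seq h₁ (.seq h₂ (.assign b (.var (b + 1)) s₂)), ?_,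
    (ha₁.trans (ha₂.mono (Nat.le_succ b))).trans (agree_setVar _ _ le_rfl), ?_⟩
  · have := hW a
    have := ht₂.trans (polynomial_eval_mono T (hs a))
    simp only [Polynomial.eval_add, Expr.cost]
    beta_reduce at *
    omega
  · rw [setVar_var_self]
    exact hv₂

/-- The least `i < m` with `P i`, or `m` if there is none. -/
noncomputable def leastBelow (m : ℕ) (P : ℕ → Prop) : ℕ := sInf {i | i = m ∨ P i}

lemma leastBelow_le (m : ℕ) (P : ℕ → Prop) : leastBelow m P ≤ m := Nat.sInf_le (Or.inl rfl)

lemma leastBelow_le_of {m i : ℕ} {P : ℕ → Prop} (h : P i) : leastBelow m P ≤ i :=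
  Nat.sInf_le (Or.inr h)

lemma leastBelow_spec_of_lt {m : ℕ} {P : ℕ → Prop} (h : ∃ i < m, P i) : P (leastBelow m P) := by
  obtain ⟨i, hi, hP⟩ := h
  have h₁ : leastBelow m P = m ∨ P (leastBelow m P) :=
    Nat.sInf_mem (s := {i | i = m ∨ P i}) ⟨m, Or.inl rfl⟩
  exact h₁.resolve_left ((leastBelow_le_of hP).trans_lt hi).ne

lemma leastBelow_spec {m : ℕ} {P : ℕ → Prop} (h : P m) : P (leastBelow m P) := by
  have h₁ : leastBelow m P = m ∨ P (leastBelow m P) :=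
    Nat.sInf_mem (s := {i | i = m ∨ P i}) ⟨m, Or.inl rfl⟩
  rcases h₁ with h₁ | h₁
  · rwa [h₁]
  · exact h₁

/-- An index below `m` is smaller than the minimum exactly if neither it nor a smaller one satisfies
`P`; the sum counts these indices. -/
lemma leastBelow_eq_sum (m : ℕ) (P : ℕ → Prop) [DecidablePred fun i => ∀ j < i + 1, ¬ P j] :
    leastBelow m P = ∑ i ∈ Finset.range m, if ∀ j < i + 1, ¬ P j then 1 else 0 := by
  rw [← Finset.card_filter, ← Finset.card_range (leastBelow m P)]
  congr 1
  ext i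
  simp only [Finset.mem_range, Finset.mem_filter]
  constructor
  · exact fun h => ⟨h.trans_le (leastBelow_le m P), fun j hj hP => by
      have := leastBelow_le_of (m := m) hP
      omega⟩
  · rintro ⟨h₁, h₂⟩
    by_contra! h
    refine h₂ _ (Nat.lt_succ_of_le h) ?_
    have h₁ : leastBelow m P = m ∨ P (leastBelow m P) :=
      Nat.sInf_mem (s := {i | i = m ∨ P i}) ⟨m, Or.inl rfl⟩
    exact h₁.resolve_left (by omega)

lemma pc_leastBelow {m : α → ℕ} {P : α → ℕ → Prop} (hm : PC m)
    (hP : PCP fun x : α × ℕ => P x.1 x.2) : PC fun a => leastBelow (m a) (P a) := by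
  classical
  refine (PC.sum (f := fun a i => if ∀ j < i + 1, ¬ P a j then 1 else 0) hm ?_).congr
    fun a => (leastBelow_eq_sum (m a) (P a)).symm
  refine PC.ite (PCP.forall_lt (PC.snd.add (PC.const 1)) (PCP.not ?_)) (PC.const 1) (PC.const 0)
  exact PC.subst (CtxMap.id.fst.fst) hP PC.snd

lemma PC.div {f g : α → ℕ} (hf : PC f) (hg : PC g) : PC fun a => f a / g a := by
  refine (PC.ite (hg.eq (PC.const 0)) (PC.const 0)
    (PC.findGreatest (P := fun a i => i * g a ≤ f a) hf
      ((PC.snd.mul hg.fst).le hf.fst))).congr fun a => ?_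
  split_ifs with h
  · simp [h]
  · have hpos : 0 < g a := Nat.pos_of_ne_zero h
    refine le_antisymm ?_ ?_
    · rw [Nat.le_div_iff_mul_le hpos]
      exact Nat.findGreatest_spec (P := fun i => i * g a ≤ f a) (Nat.zero_le _) (by simp)
    · exact Nat.le_findGreatest (Nat.div_le_self _ _) (Nat.div_mul_le_self _ _)

lemma PC.mod {f g : α → ℕ} (hf : PC f) (hg : PC g) : PC fun a => f a % g a :=
  (hf.sub (hg.mul (hf.div hg))).congr fun a => by
    have := Nat.div_add_mod (f a) (g a)
    omega

/-- Powers, capped in order to keep them small. -/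
lemma PC.min_pow {M f g : α → ℕ} (hM : PC M) (hf : PC f) (hg : PC g) :
    PC fun a => min (M a) (f a ^ g a) := by
  have key : ∀ a i, (Nat.rec (min (M a) 1) (fun _ r => min (M a) (r * f a)) i : ℕ)
      = min (M a) (f a ^ i) := by
    intro a i
    induction i with
    | zero => simp
    | succ i ih =>
      simp only [ih, pow_succ]
      rcases le_total (M a) (f a ^ i) with h | h
      · rw [min_eq_left h]
        rcases Nat.eq_zero_or_pos (f a) with h0 | h0
        · simp [h0]
        · rw [min_eq_left (Nat.le_mul_of_pos_right _ h0),
            min_eq_left (h.trans (Nat.le_mul_of_pos_right _ h0))]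
      · rw [min_eq_right h]
  exact (PC.rec (hM.minimum (PC.const 1)) hg (hM.fst.fst.minimum (PC.snd.mul hf.fst.fst)) hM.1
    fun a i _ => (key a i).trans_le (min_le_left _ _)).congr fun a => key a (g a)

lemma PC.pow_const {f : α → ℕ} (hf : PC f) (c : ℕ) : PC fun a => f a ^ c := by
  induction c with
  | zero => simpa using PC.const 1
  | succ c ih => simpa only [pow_succ] using ih.mul hf

/-- Adjacency of the vertices with numbers `u` and `v`. -/
def adj (D : Dat) (u v : ℕ) : Prop :=
  ∃ (hu : u < D.1) (hv : v < D.1), D.2.Adj ⟨u, hu⟩ ⟨v, hv⟩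

lemma adj_symm {D : Dat} {u v : ℕ} (h : adj D u v) : adj D v u := by
  obtain ⟨hu, hv, h⟩ := h
  exact ⟨hv, hu, h.symm⟩

lemma adj_ne {D : Dat} {u v : ℕ} (h : adj D u v) : u ≠ v := by
  rintro rfl
  obtain ⟨hu, hv, h⟩ := h
  exact D.2.loopless.irrefl _ h

lemma pc_adj {f g : α → ℕ} (hf : PC f) (hg : PC g) : PCP fun a => adj (dat a) (f a) (g a) := by
  refine (((hf.lt pc_order).and (hg.lt pc_order)).and
    (pcp_of_ne_zero (pc_input ((hf.mul pc_order).add hg)))).congr fun a => ?_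
  simp only [input, order, adj, true_and, ne_eq, ite_eq_right_iff,
    one_ne_zero, imp_false, not_not]
  constructor
  -- As both columns are less than `n`, the cell number determines row and column.
  · rintro ⟨⟨hf, hg⟩, u, v, h, e⟩
    have h₁ : f a = u := by
      have hpos := Nat.zero_lt_of_lt hf
      have := congrArg (· / (dat a).1) e
      simp only [mul_comm _ (dat a).1, Nat.mul_add_div hpos] at this
      rwa [Nat.div_eq_of_lt hg, Nat.div_eq_of_lt v.2] at this
    have h₂ : g a = v := by
      rw [h₁] at e
      omega
    exact ⟨hf, hg, by simpa [h₁, h₂] using h⟩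
  · rintro ⟨hf, hg, h⟩
    exact ⟨⟨hf, hg⟩, _, _, h, rfl⟩

end Boxicity

/-! ### Programs that write the output, and finite tables -/

namespace Boxicity

open Ctx

variable {α : Type} [Ctx α]

lemma exec_output_loop {b : ℕ} {X Y : Dat × ℕ → ℕ} {p q : Prog} {T U : Polynomial ℕ}
    (hp : Computes p (fun _ => 1) 4 X T) (hq : Computes q (fun _ => 1) 5 Y U) (D : Dat) {c : ℕ}
    (hc : ∀ i < b, T.eval (D.1 + i) + U.eval (D.1 + i) ≤ c) :
    ∀ (j i : ℕ), i + j = b → ∀ s : State, s.var 0 = D.1 → s.arr 0 = (input D.2).arr 0 →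
      s.var 1 = i → s.var 3 = b →
      (∀ x < i, s.arr 1 x = X (D, x) ∧ s.arr 2 x = Y (D, x)) →
      ∃ s' t, Exec (.loop (.sub (.var 3) (.var 1)) (.seq p (.seq q (.seq
        (.write 1 (.var 1) (.var 4)) (.seq (.write 2 (.var 1) (.var 5))
          (.assign 1 (.add (.var 1) (.const 1)))))))) s s' t ∧ t ≤ j * (c + 20) + 4 ∧
        s'.var 2 = s.var 2 ∧ ∀ x < b, s'.arr 1 x = X (D, x) ∧ s'.arr 2 x = Y (D, x) := by
  intro j
  induction j with
  | zero =>
    intro i hi s h0 ha0 h1 h3 hx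
    obtain rfl : i = b := by omega
    exact ⟨s, _, .loop_false (by simp [Expr.eval, h1, h3]), by simp [Expr.cost], rfl, hx⟩
  | succ j ih =>
    intro i hi s h0 ha0 h1 h3 hx
    have hb1 : Below (Dat × ℕ) (fun _ => 1) 2 := ⟨by omega, fun _ _ => one_lt_two⟩
    have hold : Holds (D, i) (fun _ => 1) s := by
      refine ⟨h0, ha0, fun y hy => ?_⟩
      exact h1
    obtain ⟨s₁, t₁, e₁, ht₁, ⟨ar₁, va₁⟩, hv₁⟩ := hp (D, i) s hold
    obtain ⟨s₂, t₂, e₂, ht₂, ⟨ar₂, va₂⟩, hv₂⟩ := hq (D, i) s₁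
      (hold.agree (b := 4) (hb1.mono (by omega)) ⟨ar₁, va₁⟩)
    have v1 : s₂.var 1 = i := by rw [va₂ 1 (by omega), va₁ 1 (by omega), h1]
    have v2 : s₂.var 2 = s.var 2 := by rw [va₂ 2 (by omega), va₁ 2 (by omega)]
    have v3 : s₂.var 3 = b := by rw [va₂ 3 (by omega), va₁ 3 (by omega), h3]
    have v0 : s₂.var 0 = D.1 := by rw [va₂ 0 (by omega), va₁ 0 (by omega), h0]
    have v4 : s₂.var 4 = X (D, i) := by rw [va₂ 4 (by omega), hv₁]
    set s₃ := ((s₂.setArr 1 (s₂.var 1) (s₂.var 4)).setArr 2 (s₂.var 1) (s₂.var 5)).setVar 1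
      (s₂.var 1 + 1) with hs₃
    obtain ⟨s', t, e, ht, h2, hx'⟩ := ih (i + 1) (by omega) s₃
      (by simpa [hs₃, State.setVar, State.setArr] using v0)
      (by simpa [hs₃, State.setVar, State.setArr, ar₂, ar₁] using ha0)
      (by simp [hs₃, v1])
      (by simpa [hs₃, State.setVar, State.setArr] using v3)
      (by
        intro x hxi
        rcases Nat.lt_succ_iff_lt_or_eq.1 hxi with hxi | rfl
        · have := hx x hxi
          simpa [hs₃, State.setVar, State.setArr, v1, Function.update_of_ne hxi.ne, ar₂, ar₁]
            using this
        · simp [hs₃, State.setVar, State.setArr, v1, v4, hv₂])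
    refine ⟨s', _, .loop_true ?_ (.seq e₁ (.seq e₂ (.seq (.write 1 (.var 1) (.var 4) s₂)
      (.seq (.write 2 (.var 1) (.var 5) _)
        (.assign 1 (.add (.var 1) (.const 1)) _))))) e, ?_, ?_, hx'⟩
    · simp only [Expr.eval, h1, h3]
      omega
    · have := hc i (by omega)
      simp only [size_prod, size_dat] at ht₁ ht₂
      simp only [Expr.cost]
      have e : (j + 1) * (c + 20) = j * (c + 20) + (c + 20) := by ring
      rw [e]
      omega
    · rw [h2, ← v2]
      simp [hs₃, State.setVar, State.setArr]

/-- A program that puts `d` into variable `0` and the first `b` values of `X` and `Y` into the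
arrays `1` and `2`. -/
theorem exists_exec_output {d b : Dat → ℕ} {X Y : Dat × ℕ → ℕ} (hd : PC d) (hb : PC b) (hX : PC X)
    (hY : PC Y) : ∃ (p : Prog) (T : Polynomial ℕ), ∀ D : Dat, ∃ (s : State) (t : ℕ),
      Exec p (input D.2) s t ∧ t ≤ T.eval D.1 ∧ s.var 0 = d D ∧
        ∀ x < b D, s.arr 1 x = X (D, x) ∧ s.arr 2 x = Y (D, x) := by
  obtain ⟨-, Td, hd⟩ := hd
  obtain ⟨hbb, Tb, hb⟩ := hb
  obtain ⟨-, T, hX⟩ := hX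
  obtain ⟨-, U, hY⟩ := hY
  have hB : ∀ c, Below Dat (fun _ => 1) (c + 1) := fun c => ⟨by omega, fun i hi => absurd hi (by
    change ¬ i < 0
    omega)⟩
  have hB' : ∀ c, Below (Dat × ℕ) (fun _ => 1) (c + 2) := fun c =>
    ⟨by omega, fun i hi => by beta_reduce; omega⟩
  obtain ⟨pd, hpd⟩ := hd _ 2 (hB 1)
  obtain ⟨pb, hpb⟩ := hb _ 3 (hB 2)
  obtain ⟨px, hpx⟩ := hX _ 4 (hB' 2)
  obtain ⟨py, hpy⟩ := hY _ 5 (hB' 3)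
  have hsb := (polyBounded_size (α := Dat)).add hbb
  obtain ⟨W, hW⟩ := (hbb.mul (((hsb.eval T).add (hsb.eval U)).add
    (polyBounded_const 20))).add (polyBounded_const 20)
  -- The computations need the order of the graph in variable `0`, so the dimension waits in
  -- variable `2` until the end. Variable `3` holds the number of cells, variable `1` the running
  -- index, which is zero in the input.
  refine ⟨.seq pd (.seq pb (.seq (.loop (.sub (.var 3) (.var 1)) (.seq px (.seq py (.seq
    (.write 1 (.var 1) (.var 4)) (.seq (.write 2 (.var 1) (.var 5))
      (.assign 1 (.add (.var 1) (.const 1)))))))) (.assign 0 (.var 2)))), Td + Tb + W,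
    fun D => ?_⟩
  have h0 : Holds D (fun _ => 1) (input D.2) := ⟨rfl, rfl, fun i hi => absurd hi (by
    change ¬ i < 0
    omega)⟩
  obtain ⟨s₁, t₁, e₁, ht₁, ha₁, hv₁⟩ := hpd D _ h0
  have h1 := h0.agree (hB 1) ha₁
  obtain ⟨s₂, t₂, e₂, ht₂, ha₂, hv₂⟩ := hpb D _ h1
  have h2 := h1.agree (hB 2) ha₂
  obtain ⟨s₃, t₃, e₃, ht₃, hv₃, hx⟩ := exec_output_loop hpx hpy D
    (c := T.eval (D.1 + b D) + U.eval (D.1 + b D))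
    (fun i hi => add_le_add (polynomial_eval_mono T (by omega))
      (polynomial_eval_mono U (by omega))) (b D) 0 (by omega) s₂ h2.var_zero h2.arr_zero
    (by rw [ha₂.2 1 (by omega), ha₁.2 1 (by omega)]; rfl) hv₂ (fun x hx => absurd hx (by omega))
  refine ⟨_, _, .seq e₁ (.seq e₂ (.seq e₃ (.assign 0 (.var 2) s₃))), ?_, ?_, hx⟩
  · have := hW D
    simp only [size_dat] at *
    simp only [Polynomial.eval_add, Expr.cost]
    omega
  · rw [setVar_var_self]
    simp only [Expr.eval]
    rw [hv₃, ha₂.2 2 (by omega), hv₁]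

lemma PCP.forall_mem {ι : Type*} (S : Finset ι) {P : ι → α → Prop} (h : ∀ i, PCP (P i)) :
    PCP fun a => ∀ i ∈ S, P i a := by
  classical
  induction S using Finset.induction_on with
  | empty => simpa [PCP] using PC.const 1
  | insert i S _ ih => exact ((h i).and ih).congr fun a => by simp

lemma PC.finset_sum {ι : Type*} (S : Finset ι) {f : ι → α → ℕ} (h : ∀ i, PC (f i)) :
    PC fun a => ∑ i ∈ S, f i a := by
  classical
  induction S using Finset.induction_on with
  | empty => simpa using PC.const 0
  | insert i S hi ih => exact ((h i).add ih).congr fun a => by rw [Finset.sum_insert hi]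

lemma dat_ext_iff (D D' : Dat) :
    D = D' ↔ D.1 = D'.1 ∧ ∀ u < D'.1, ∀ v < D'.1, adj D u v ↔ adj D' u v := by
  constructor
  · rintro rfl
    exact ⟨rfl, fun _ _ _ _ => Iff.rfl⟩
  · obtain ⟨n, G⟩ := D
    obtain ⟨n', G'⟩ := D'
    rintro ⟨h, h'⟩
    obtain rfl : n = n' := h
    congr 1
    ext u v
    have := h' u u.2 v v.2
    simpa [adj] using this

/-- As `D` is fixed, this is a conjunction whose length does not depend on the input. -/
lemma PCP.dat_eq (D : Dat) : PCP fun a : α => dat a = D := by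
  classical
  have h : ∀ u v, PCP fun a : α => (adj (dat a) u v ↔ adj D u v) := fun u v => by
    have := pc_adj (α := α) (PC.const u) (PC.const v)
    by_cases h : adj D u v
    · simpa [h] using this
    · simpa [h] using this.not
  refine ((pc_order.eq (PC.const D.1)).and (PCP.forall_mem (Finset.range D.1)
    fun u => PCP.forall_mem (Finset.range D.1) fun v => h u v)).congr fun a => ?_
  rw [dat_ext_iff]
  simp only [Finset.mem_range]
  rfl

open Classical in
/-- Finitely many values can be looked up in a table. -/
lemma PC.table (S : Finset Dat) (m : ℕ) (F : Dat → ℕ → ℕ) {f : α → ℕ} (hf : PC f) :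
    PC fun a => if dat a ∈ S ∧ f a < m then F (dat a) (f a) else 0 := by
  refine (PC.finset_sum S fun D => PC.finset_sum (Finset.range m) fun x =>
    PC.ite ((PCP.dat_eq D).and (hf.eq (PC.const x))) (PC.const (F D x)) (PC.const 0)).congr
    fun a => ?_
  simp only [ite_and]
  simp only [Finset.sum_ite_irrel, Finset.sum_const_zero, Finset.sum_ite_eq, Finset.mem_range]

end Boxicity

/-! ### Interval families on a block and their extension to all vertices -/

namespace Boxicity

open Ctx

open Classical in
/-- The right end point of the vertex `v` if the intervals `[l a, r a]` are given for the vertices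
`a` of the `i`-th block: outside the block, as small as the neighbours in the block permit. -/
noncomputable def upper (D : Dat) (k i : ℕ) (l r : ℕ → ℕ) (v : ℕ) : ℕ :=
  if v / k = i then r v
  else (Finset.range D.1).sup fun a => if a / k = i ∧ adj D v a then l a else 0

open Classical in
/-- The left end point of the vertex `v` if the intervals `[l a, r a]` are given for the vertices
`a` of the `i`-th block: outside the block, as large as the neighbours in the block permit. -/
noncomputable def lower (D : Dat) (k i : ℕ) (l r : ℕ → ℕ) (v : ℕ) : ℕ :=
  if v / k = i then l v
  else (2 * k + 1) -
    (Finset.range D.1).sup fun a => if a / k = i ∧ adj D v a then 2 * k + 1 - r a else 0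

section

variable {D : Dat} {k i : ℕ} {l r : ℕ → ℕ} {u v x : ℕ}

lemma upper_of_mem (h : v / k = i) : upper D k i l r v = r v := if_pos h

lemma lower_of_mem (h : v / k = i) : lower D k i l r v = l v := if_pos h

lemma le_upper (hv : v / k ≠ i) (hu : u / k = i) (h : adj D v u) : l u ≤ upper D k i l r v := by
  classical
  rw [upper, if_neg hv]
  have := Finset.le_sup (f := fun a => if a / k = i ∧ adj D v a then l a else 0)
    (Finset.mem_range.2 (adj_symm h).1)
  simpa [hu, h] using this

lemma lower_le (hv : v / k ≠ i) (hu : u / k = i) (h : adj D v u) : lower D k i l r v ≤ r u := by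
  classical
  rw [lower, if_neg hv]
  have := Finset.le_sup (f := fun a => if a / k = i ∧ adj D v a then 2 * k + 1 - r a else 0)
    (Finset.mem_range.2 (adj_symm h).1)
  simp only [hu, h, and_self, if_true] at this
  omega

lemma upper_le (hl : ∀ a, l a ≤ 2 * k + 1) (hr : ∀ a, r a ≤ 2 * k + 1) :
    upper D k i l r v ≤ 2 * k + 1 := by
  rw [upper]
  split_ifs
  · exact hr v
  · refine Finset.sup_le fun a _ => ?_
    split_ifs
    · exact hl a
    · exact Nat.zero_le _

lemma lower_le_bound (hl : ∀ a, l a ≤ 2 * k + 1) : lower D k i l r v ≤ 2 * k + 1 := by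
  rw [lower]
  split_ifs
  · exact hl v
  · exact Nat.sub_le _ _

/-- The hypothesis `0 < x` is for vertices without neighbours in the block, whose supremum is zero.
-/
lemma upper_lt (hv : v / k ≠ i) (hx : 0 < x) (h : ∀ a, a / k = i → adj D v a → l a < x) :
    upper D k i l r v < x := by
  rw [upper, if_neg hv, Finset.sup_lt_iff (by simpa using hx)]
  intro a _
  split_ifs with ha
  · exact h a ha.1 ha.2
  · exact hx

/-- The minimum is written as a reflected supremum, so without neighbours in the block it is `2 * k
+ 1`; hence the hypothesis on `x`. -/
lemma lt_lower (hv : v / k ≠ i) (hx : x < 2 * k + 1) (h : ∀ a, a / k = i → adj D v a → x < r a) :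
    x < lower D k i l r v := by
  classical
  rw [lower, if_neg hv]
  suffices (Finset.range D.1).sup (fun a => if a / k = i ∧ adj D v a then 2 * k + 1 - r a else 0)
    < 2 * k + 1 - x by omega
  rw [Finset.sup_lt_iff (by simpa using hx)]
  intro a _
  split_ifs with ha
  · have := h a ha.1 ha.2
    omega
  · omega

lemma upper_congr {l' r' : ℕ → ℕ} (h : ∀ a, a / k = i → l a = l' a ∧ r a = r' a) :
    upper D k i l r v = upper D k i l' r' v := by
  rw [upper, upper]
  split_ifs with hv
  · exact (h v hv).2
  · refine Finset.sup_congr rfl fun a _ => ?_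
    split_ifs with ha
    · exact (h a ha.1).1
    · rfl

lemma lower_congr {l' r' : ℕ → ℕ} (h : ∀ a, a / k = i → l a = l' a ∧ r a = r' a) :
    lower D k i l r v = lower D k i l' r' v := by
  rw [lower, lower]
  split_ifs with hv
  · exact (h v hv).1
  · congr 1
    refine Finset.sup_congr rfl fun a _ => ?_
    split_ifs with ha
    · rw [(h a ha.1).2]
    · rfl

end

/-- The `e` families of intervals `[l j u, r j u]` of the vertices of the `i`-th block preserve
adjacency inside the block and separate the vertices of the block from all their non-neighbours. -/
def Separates (D : Dat) (k i e : ℕ) (l r : ℕ → ℕ → ℕ) : Prop :=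
  ∀ u < D.1, u / k = i → (∀ j < e, l j u ≤ r j u) ∧ ∀ v < D.1, v ≠ u →
    (adj D u v → v / k = i → ∀ j < e, l j u ≤ r j v) ∧
    (¬ adj D u v → ∃ j < e, upper D k i (l j) (r j) v < l j u ∨ r j u < lower D k i (l j) (r j) v)

/-- Only the values on the block matter, so families may be replaced by what their codes describe.
-/
lemma Separates.congr {D : Dat} {k i e : ℕ} {l r l' r' : ℕ → ℕ → ℕ} (h : Separates D k i e l r)
    (hlr : ∀ j < e, ∀ a, a / k = i → l j a = l' j a ∧ r j a = r' j a) :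
    Separates D k i e l' r' := by
  intro u hu hui
  obtain ⟨h₁, h₂⟩ := h u hu hui
  refine ⟨fun j hj => ?_, fun v hv hvu => ⟨fun ha hvi j hj => ?_, fun ha => ?_⟩⟩
  · rw [← (hlr j hj u hui).1, ← (hlr j hj u hui).2]
    exact h₁ j hj
  · rw [← (hlr j hj u hui).1, ← (hlr j hj v hvi).2]
    exact (h₂ v hv hvu).1 ha hvi j hj
  · obtain ⟨j, hj, h⟩ := (h₂ v hv hvu).2 ha
    refine ⟨j, hj, ?_⟩
    rwa [← upper_congr (hlr j hj), ← lower_congr (hlr j hj), ← (hlr j hj u hui).1,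
      ← (hlr j hj u hui).2]

/-- Left end points of the two interval graphs that belong to a family of intervals of the `i`-th
block. In the first of them the vertices outside the block share the point `0`, in the second they
share the point `2 * k + 1`. -/
noncomputable def boxLeft (D : Dat) (k i : ℕ) (l r : ℕ → ℕ) (o v : ℕ) : ℕ :=
  if o = 0 then if v / k = i then l v else 0 else lower D k i l r v

/-- Right end points, see `boxLeft`. -/
noncomputable def boxRight (D : Dat) (k i : ℕ) (l r : ℕ → ℕ) (o v : ℕ) : ℕ :=
  if o = 0 then upper D k i l r v else if v / k = i then r v else 2 * k + 1

section

variable {D : Dat} {k i e t : ℕ}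

lemma boxLeft_le_boxRight {l r : ℕ → ℕ → ℕ} (h : Separates D k i e l r)
    {j o v : ℕ} (hj : j < e) (hv : v < D.1) :
    boxLeft D k i (l j) (r j) o v ≤ boxRight D k i (l j) (r j) o v := by
  rw [boxLeft, boxRight]
  by_cases hvi : v / k = i
  · simpa [hvi, upper, lower] using (h v hv hvi).1 j hj
  · by_cases ho : o = 0
    · simp [hvi, ho]
    · simp only [hvi, ho, if_false, lower]
      exact Nat.sub_le _ _

/-- The extension reaches all neighbours in the block, and two vertices outside share `0` or `2 * k
+ 1`. -/
lemma boxLeft_le_boxRight_of_adj {l r : ℕ → ℕ → ℕ} (h : Separates D k i e l r)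
    (hl : ∀ j a, l j a ≤ 2 * k + 1) {j o u v : ℕ} (hj : j < e) (ha : adj D u v) :
    boxLeft D k i (l j) (r j) o u ≤ boxRight D k i (l j) (r j) o v := by
  have hu : u < D.1 := ha.1
  have hv : v < D.1 := ha.2.1
  rw [boxLeft, boxRight]
  by_cases hui : u / k = i <;> by_cases hvi : v / k = i <;> by_cases ho : o = 0
  · simpa [hui, hvi, ho, upper] using ((h u hu hui).2 v hv (adj_ne ha).symm).1 ha hvi j hj
  · simpa [hui, hvi, ho, lower] using ((h u hu hui).2 v hv (adj_ne ha).symm).1 ha hvi j hj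
  · simpa [hui, ho] using le_upper hvi hui (adj_symm ha)
  · simpa [hvi, ho] using lower_le_bound (hl j)
  · simp [hui, ho]
  · simpa [hvi, ho] using lower_le hui hvi ha
  · simp [hui, ho]
  · simpa [hvi, ho] using lower_le_bound (hl j)

/-- Separating families for all blocks give a box representation. -/
theorem adj_iff_boxes {l r : ℕ → ℕ → ℕ → ℕ} (h : ∀ i < t, Separates D k i e (l i) (r i))
    (hl : ∀ i j a, l i j a ≤ 2 * k + 1) (hk : 0 < k) (ht : D.1 ≤ t * k) {u v : ℕ} (hu : u < D.1)
    (hv : v < D.1) : adj D u v ↔ u ≠ v ∧ ∀ i < t, ∀ j < e, ∀ o < 2,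
      boxLeft D k i (l i j) (r i j) o u ≤ boxRight D k i (l i j) (r i j) o v ∧
      boxLeft D k i (l i j) (r i j) o v ≤ boxRight D k i (l i j) (r i j) o u := by
  refine ⟨fun ha => ⟨adj_ne ha, fun i hi j hj o _ =>
    ⟨boxLeft_le_boxRight_of_adj (h i hi) (hl i) hj ha,
      boxLeft_le_boxRight_of_adj (h i hi) (hl i) hj (adj_symm ha)⟩⟩, ?_⟩
  rintro ⟨huv, hI⟩
  by_contra ha
  have hi : u / k < t := by
    rw [Nat.div_lt_iff_lt_mul hk]
    omega
  obtain ⟨j, hj, h'⟩ := ((h _ hi u hu rfl).2 v hv huv.symm).2 ha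
  -- In the block of `u`, a vertex `v` to the left of `u` is detected by the graph `o = 0`, one to
  -- the right by `o = 1`.
  rcases h' with h' | h'
  · have := (hI _ hi j hj 0 (by omega)).1
    simp only [boxLeft, boxRight, if_true] at this
    omega
  · have := (hI _ hi j hj 1 (by omega)).2
    simp only [boxLeft, boxRight, if_true, one_ne_zero, if_false] at this
    omega

/-- The vertices of a block have different labels, the vertices outside all have the label `k`. -/
def label (k i v : ℕ) : ℕ := if v / k = i then v % k else k

/-- The binary digit of `x ≤ n` at place `h`. -/
def bitBelow (n x h : ℕ) : ℕ := x / min (n + 1) (2 ^ h) % 2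

lemma bitBelow_eq {n x h : ℕ} (hx : x ≤ n) : bitBelow n x h = x / 2 ^ h % 2 := by
  rw [bitBelow]
  rcases le_total (n + 1) (2 ^ h) with h' | h'
  · rw [min_eq_left h', Nat.div_eq_of_lt (by omega), Nat.div_eq_of_lt (by omega)]
  · rw [min_eq_right h']

lemma exists_bitBelow_ne {n x y q : ℕ} (hx : x ≤ n) (hy : y ≤ n) (hxq : x < 2 ^ q) (hyq : y < 2 ^ q)
    (hxy : x ≠ y) : ∃ h < q, bitBelow n x h ≠ bitBelow n y h := by
  by_contra! H
  refine hxy (Nat.eq_of_testBit_eq fun h => ?_)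
  rcases lt_or_ge h q with hq | hq
  · have := H h hq
    rw [bitBelow_eq hx, bitBelow_eq hy] at this
    rw [Nat.testBit_eq_decide_div_mod_eq, Nat.testBit_eq_decide_div_mod_eq, this]
  · have := Nat.pow_le_pow_right (n := 2) (by omega) hq
    rw [Nat.testBit_lt_two_pow (hxq.trans_le this), Nat.testBit_lt_two_pow (hyq.trans_le this)]

/-- Numerators of the left end points, over the denominator `2 * k + 1`, of the unit intervals that
belong to a family of intervals of the `i`-th block. The vertices are split in two according to the
digit at place `h` of their label. -/
noncomputable def cubeNum (D : Dat) (k i : ℕ) (l r : ℕ → ℕ) (h o v : ℕ) : ℕ :=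
  if bitBelow D.1 (label k i v) h = o then upper D k i l r v else 2 * k + 1 + lower D k i l r v

/-- Numerators of one class lie in `[0, 2 * k + 1]`, those of the other in `[2 * k + 1, 4 * k + 2]`,
so only pairs from different classes need adjacency. -/
lemma cubeNum_le_of_adj {l r : ℕ → ℕ → ℕ} (hs : Separates D k i e l r)
    (hl : ∀ j a, l j a ≤ 2 * k + 1) (hr : ∀ j a, r j a ≤ 2 * k + 1) {j h o u v : ℕ} (hj : j < e)
    (ha : adj D u v) : cubeNum D k i (l j) (r j) h o u ≤
      cubeNum D k i (l j) (r j) h o v + (2 * k + 1) := by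
  have hu : u < D.1 := ha.1
  have hv : v < D.1 := ha.2.1
  have b₁ := upper_le (D := D) (i := i) (v := u) (hl j) (hr j)
  have b₂ := lower_le_bound (D := D) (i := i) (v := u) (r := r j) (hl j)
  rw [cubeNum, cubeNum]
  by_cases h₁ : bitBelow D.1 (label k i u) h = o <;>
    by_cases h₂ : bitBelow D.1 (label k i v) h = o
  · rw [if_pos h₁, if_pos h₂]
    omega
  · rw [if_pos h₁, if_neg h₂]
    omega
  · rw [if_neg h₁, if_pos h₂]
    suffices lower D k i (l j) (r j) u ≤ upper D k i (l j) (r j) v by omega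
    by_cases hui : u / k = i <;> by_cases hvi : v / k = i
    · rw [lower_of_mem hui, upper_of_mem hvi]
      exact ((hs u hu hui).2 v hv (adj_ne ha).symm).1 ha hvi j hj
    · rw [lower_of_mem hui]
      exact le_upper hvi hui (adj_symm ha)
    · rw [upper_of_mem hvi]
      exact lower_le hui hvi ha
    -- Two vertices outside the block have the same label, hence cannot be in different classes.
    · rw [label, if_neg hui] at h₁
      rw [label, if_neg hvi] at h₂
      exact absurd h₂ h₁
  · rw [if_neg h₁, if_neg h₂]
    omega

/-- Separating families for all blocks give a cube representation. -/
theorem adj_iff_cubes {l r : ℕ → ℕ → ℕ → ℕ} (hs : ∀ i < t, Separates D k i e (l i) (r i))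
    (hl : ∀ i j a, l i j a ≤ 2 * k + 1) (hr : ∀ i j a, r i j a ≤ 2 * k + 1) (hk : 0 < k)
    (hkn : k ≤ D.1) (ht : D.1 ≤ t * k) {q : ℕ} (hq : k < 2 ^ q) {u v : ℕ} (hu : u < D.1)
    (hv : v < D.1) : adj D u v ↔ u ≠ v ∧ ∀ i < t, ∀ j < e, ∀ h < q, ∀ o < 2,
      cubeNum D k i (l i j) (r i j) h o u ≤
        cubeNum D k i (l i j) (r i j) h o v + (2 * k + 1) ∧
      cubeNum D k i (l i j) (r i j) h o v ≤
        cubeNum D k i (l i j) (r i j) h o u + (2 * k + 1) := by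
  refine ⟨fun ha => ⟨adj_ne ha, fun i hi j hj h _ o _ =>
    ⟨cubeNum_le_of_adj (hs i hi) (hl i) (hr i) hj ha,
      cubeNum_le_of_adj (hs i hi) (hl i) (hr i) hj (adj_symm ha)⟩⟩, ?_⟩
  rintro ⟨huv, hI⟩
  by_contra ha
  have hi : u / k < t := by
    rw [Nat.div_lt_iff_lt_mul hk]
    omega
  obtain ⟨j, hj, h'⟩ := ((hs _ hi u hu rfl).2 v hv huv.symm).2 ha
  have hlu : label k (u / k) u = u % k := if_pos rfl
  have hmod : u % k < k := Nat.mod_lt _ hk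
  have hlv : label k (u / k) v ≤ k ∧ label k (u / k) v ≠ u % k := by
    rw [label]
    split_ifs with hvi
    · refine ⟨(Nat.mod_lt _ hk).le, fun hm => huv ?_⟩
      rw [← Nat.div_add_mod u k, ← Nat.div_add_mod v k, hvi, hm]
    · exact ⟨le_rfl, hmod.ne'⟩
  obtain ⟨h, hh, hne⟩ := exists_bitBelow_ne (n := D.1) (x := label k (u / k) u)
    (y := label k (u / k) v) (q := q) (by omega) (by omega) (by omega) (by omega)
    (by rw [hlu]; exact hlv.2.symm)
  -- The choice of `o` puts the left one of the two vertices into the class placed at `upper`.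
  rcases h' with h' | h'
  · have := (hI _ hi j hj h hh (bitBelow D.1 (label k (u / k) v) h) (Nat.mod_lt _ two_pos)).1
    rw [cubeNum, cubeNum, if_neg hne, if_pos rfl, lower_of_mem rfl] at this
    omega
  · have := (hI _ hi j hj h hh (bitBelow D.1 (label k (u / k) u) h) (Nat.mod_lt _ two_pos)).2
    rw [cubeNum, cubeNum, if_neg hne.symm, if_pos rfl, upper_of_mem rfl] at this
    omega

/-- One family for every vertex of the block suffices. -/
lemma exists_separates_self (D : Dat) (k i : ℕ) (hk : 0 < k) : ∃ l r : ℕ → ℕ → ℕ,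
    (∀ j a, l j a ≤ 2 * k) ∧ (∀ j a, r j a ≤ 2 * k) ∧ Separates D k i k l r := by
  classical
  have hdm : ∀ u, u / k = i → u = k * i + u % k := fun u hu => by
    rw [← hu, Nat.div_add_mod]
  -- In family `j` the vertex with residue `j` gets the point `2`, its neighbours in the block get
  -- `[1, 2]`, all others in the block the point `1`.
  refine ⟨fun j a => if a % k = j then 2 else 1,
    fun j a => if a % k = j ∨ adj D a (k * i + j) then 2 else 1, fun j a => ?_, fun j a => ?_, ?_⟩
  · beta_reduce
    split_ifs <;> omega
  · beta_reduce
    split_ifs <;> omega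
  intro u hu hui
  refine ⟨fun j _ => ?_, fun v hv hvu => ⟨fun ha hvi j _ => ?_, fun ha =>
    ⟨u % k, Nat.mod_lt _ hk, Or.inl ?_⟩⟩⟩
  · by_cases h : u % k = j
    · simp [h]
    · simp only [h, if_false]
      split_ifs <;> omega
  · by_cases h : u % k = j
    · have : adj D v (k * i + j) := by
        rw [← h, ← hdm u hui]
        exact adj_symm ha
      simp only [this, or_true, if_true]
      split_ifs
      omega
    · simp only [h, if_false]
      split_ifs <;> omega
  · by_cases hvi : v / k = i
    · rw [upper_of_mem hvi]
      beta_reduce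
      rw [← hdm u hui, if_pos rfl, if_neg]
      · omega
      rintro (h | h)
      · exact hvu (by rw [hdm v hvi, hdm u hui, h])
      · exact ha (adj_symm h)
    · refine (upper_lt hvi two_pos fun a hai hva => ?_).trans_eq (if_pos rfl).symm
      beta_reduce
      rw [if_neg]
      · omega
      intro h
      obtain rfl : a = u := by rw [hdm a hai, hdm u hui, h]
      exact ha (adj_symm hva)

/-- Replace finitely many real numbers by their ranks. -/
lemma exists_rank (A : Finset ℕ) {m : ℕ} (hA : A.card ≤ m) (l r : ℕ → ℝ) :
    ∃ f : ℝ → ℕ, (∀ x, f x ≤ 2 * m) ∧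
      (∀ x ∈ A.image l ∪ A.image r, 1 ≤ f x) ∧
      ∀ x ∈ A.image l ∪ A.image r, ∀ y ∈ A.image l ∪ A.image r, f x < f y ↔ x < y := by
  set S := A.image l ∪ A.image r with hS
  have hc : S.card ≤ 2 * m := by
    have h₁ := Finset.card_union_le (A.image l) (A.image r)
    rw [← hS] at h₁
    have h₂ := Finset.card_image_le (s := A) (f := l)
    have h₃ := Finset.card_image_le (s := A) (f := r)
    omega
  -- Counting `x` itself makes ranks on `S` positive, which leaves `0` for vertices without
  -- neighbours in the block.
  refine ⟨fun x => (S.filter (· ≤ x)).card, fun x => (Finset.card_filter_le _ _).trans hc,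
    fun x hx => Finset.card_pos.2 ⟨x, Finset.mem_filter.2 ⟨hx, le_rfl⟩⟩, fun x hx y hy => ?_⟩
  have hmono : ∀ x y : ℝ, x ≤ y → (S.filter (· ≤ x)).card ≤ (S.filter (· ≤ y)).card :=
    fun x y h => Finset.card_le_card (Finset.monotone_filter_right S fun z _ hz => hz.trans h)
  constructor
  · intro h
    by_contra! h'
    exact absurd (hmono y x h') (by simpa using h)
  · intro h
    refine Finset.card_lt_card (Finset.ssubset_iff_of_subset
      (Finset.monotone_filter_right S fun z _ hz => hz.trans h.le) |>.2 ⟨y, ?_, ?_⟩)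
    · exact Finset.mem_filter.2 ⟨hy, le_rfl⟩
    · simp [h]

/-- A box representation restricts to separating families. -/
lemma exists_separates_of_boxes (hk : 0 < k) (i : ℕ) {l r : ℕ → ℕ → ℝ}
    (hlr : ∀ j < e, ∀ v, l j v ≤ r j v)
    (h : ∀ u < D.1, ∀ v < D.1, adj D u v ↔ u ≠ v ∧ ∀ j < e, l j u ≤ r j v ∧ l j v ≤ r j u) :
    ∃ l' r' : ℕ → ℕ → ℕ, (∀ j a, l' j a ≤ 2 * k) ∧ (∀ j a, r' j a ≤ 2 * k) ∧
      Separates D k i e l' r' := by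
  set A := Finset.Ico (k * i) (k * (i + 1)) with hA
  have hmem : ∀ a, a / k = i ↔ a ∈ A := fun a => by
    rw [hA, Finset.mem_Ico, Nat.div_eq_iff hk, mul_comm k i, mul_add, mul_one, mul_comm k i]
    omega
  have hcard : A.card ≤ k := by simp [hA, mul_add]
  choose f hf₁ hf₂ hf₃ using fun j => exists_rank A hcard (l j) (r j)
  have hL : ∀ j a, a / k = i → l j a ∈ A.image (l j) ∪ A.image (r j) := fun j a ha =>
    Finset.mem_union_left _ (Finset.mem_image_of_mem _ ((hmem a).1 ha))
  have hR : ∀ j a, a / k = i → r j a ∈ A.image (l j) ∪ A.image (r j) := fun j a ha =>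
    Finset.mem_union_right _ (Finset.mem_image_of_mem _ ((hmem a).1 ha))
  have hle : ∀ j a b, a / k = i → b / k = i → l j a ≤ r j b → f j (l j a) ≤ f j (r j b) := by
    intro j a b ha hb hab
    by_contra! hlt
    exact absurd ((hf₃ j _ (hR j b hb) _ (hL j a ha)).1 hlt) (not_lt.2 hab)
  refine ⟨fun j a => f j (l j a), fun j a => f j (r j a), fun j a => hf₁ j _, fun j a => hf₁ j _,
    fun u hu hui => ⟨fun j hj => hle j u u hui hui (hlr j hj u), fun v hv hvu =>
      ⟨fun ha hvi j hj => hle j u v hui hvi (((h u hu v hv).1 ha).2 j hj).1, fun ha => ?_⟩⟩⟩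
  rw [h u hu v hv] at ha
  push Not at ha
  obtain ⟨j, hj, hlt⟩ := ha hvu.symm
  refine ⟨j, hj, ?_⟩
  rcases le_or_gt (l j u) (r j v) with h' | h'
  · right
    have hlt := hlt h'
    by_cases hvi : v / k = i
    · rw [lower_of_mem hvi]
      exact (hf₃ j _ (hR j u hui) _ (hL j v hvi)).2 hlt
    -- Every neighbour `a` of `v` in the block has `r u < l v ≤ r a`, so the greedy left end point
    -- of `v` stays to the right of `u`.
    · refine lt_lower hvi (Nat.lt_succ_of_le (hf₁ j _)) fun a ha hva => ?_
      exact (hf₃ j _ (hR j u hui) _ (hR j a ha)).2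
        (hlt.trans_le (((h v hv a hva.2.1).1 hva).2 j hj).1)
  · left
    by_cases hvi : v / k = i
    · rw [upper_of_mem hvi]
      exact (hf₃ j _ (hR j v hvi) _ (hL j u hui)).2 h'
    · refine upper_lt hvi (hf₂ j _ (hL j u hui)) fun a ha hva => ?_
      exact (hf₃ j _ (hL j a ha) _ (hL j u hui)).2
        (lt_of_le_of_lt (((h v hv a hva.2.1).1 hva).2 j hj).2 h')

end

end Boxicity

/-! ### Exhaustive search for separating families -/

namespace Boxicity

open Ctx

/-- The size of the blocks. -/
def blockSize (n : ℕ) : ℕ :=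
  Nat.findGreatest (fun j => min (n ^ 8 + 1) ((2 * j + 1) ^ (2 * j * j)) ≤ n ^ 8) n

/-- The number of blocks. -/
def numBlocks (n : ℕ) : ℕ := (n + blockSize n - 1) / blockSize n

/-- The number of binary digits of the labels. -/
def numBits (n : ℕ) : ℕ :=
  Nat.findGreatest (fun j => min (n + 1) (2 ^ j) ≤ blockSize n) (blockSize n) + 1

/-- The digit of `c < n ^ 8` in base `2 * k + 1` at place `x`. -/
def digit (n k c x : ℕ) : ℕ := c / min (n ^ 8) ((2 * k + 1) ^ x) % (2 * k + 1)

/-- The left end points of the families of intervals with code `c`. -/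
def codeLeft (n k c j a : ℕ) : ℕ := digit n k c ((j * k + a % k) * 2)

/-- The right end points of the families of intervals with code `c`. -/
def codeRight (n k c j a : ℕ) : ℕ := digit n k c ((j * k + a % k) * 2 + 1)

/-- `c` is the code of `e` separating families of intervals of the `i`-th block. -/
def IsCode (D : Dat) (i e c : ℕ) : Prop :=
  Separates D (blockSize D.1) i e (codeLeft D.1 (blockSize D.1) c) (codeRight D.1 (blockSize D.1) c)

/-- The least number of families that can be found for each of the blocks. -/
noncomputable def numFamilies (D : Dat) : ℕ :=
  leastBelow (blockSize D.1) fun e => ∀ i < numBlocks D.1, ∃ c < D.1 ^ 8, IsCode D i e c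

/-- The code found for the `i`-th block. -/
noncomputable def codeOf (D : Dat) (i : ℕ) : ℕ :=
  leastBelow (D.1 ^ 8) fun c => IsCode D i (numFamilies D) c

section Computability

variable {α : Type} [Ctx α]

/-- The cap `n ^ 8 + 1` does not affect the comparison with `n ^ 8`, but keeps the power
polynomially bounded. -/
lemma pc_blockSize : PC fun a : α => blockSize (order a) := by
  have hn : PC fun x : α × ℕ => order x.1 ^ 8 := pc_order.fst.pow_const 8
  exact PC.findGreatest (P := fun a j => min (order a ^ 8 + 1)
    ((2 * j + 1) ^ (2 * j * j)) ≤ order a ^ 8) pc_order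
    ((PC.min_pow (hn.add (PC.const 1)) (((PC.const 2).mul PC.snd).add (PC.const 1))
      (((PC.const 2).mul PC.snd).mul PC.snd)).le hn)

lemma pc_numBlocks : PC fun a : α => numBlocks (order a) :=
  ((pc_order.add pc_blockSize).sub (PC.const 1)).div pc_blockSize

lemma pc_numBits : PC fun a : α => numBits (order a) :=
  (PC.findGreatest (P := fun a j => min (order a + 1) (2 ^ j) ≤
      blockSize (order a)) pc_blockSize
    ((PC.min_pow (pc_order.fst.add (PC.const 1)) (PC.const 2) PC.snd).le pc_blockSize.fst)).add
    (PC.const 1)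

variable {k c i e j v x : α → ℕ}

/-- Here too the cap is harmless: for `c < n ^ 8` a power beyond it would give the quotient zero
anyway. -/
lemma pc_digit (hk : PC k) (hc : PC c) (hx : PC x) :
    PC fun a => digit (order a) (k a) (c a) (x a) :=
  have hB := ((PC.const 2).mul hk).add (PC.const 1)
  (hc.div (PC.min_pow (pc_order.pow_const 8) hB hx)).mod hB

lemma pc_codeLeft (hk : PC k) (hc : PC c) (hj : PC j) (hv : PC v) :
    PC fun a => codeLeft (order a) (k a) (c a) (j a) (v a) :=
  pc_digit hk hc (((hj.mul hk).add (hv.mod hk)).mul (PC.const 2))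

lemma pc_codeRight (hk : PC k) (hc : PC c) (hj : PC j) (hv : PC v) :
    PC fun a => codeRight (order a) (k a) (c a) (j a) (v a) :=
  pc_digit hk hc ((((hj.mul hk).add (hv.mod hk)).mul (PC.const 2)).add (PC.const 1))

variable {l r : α → ℕ → ℕ}

lemma pc_upper (hk : PC k) (hi : PC i) (hl : PC fun x : α × ℕ => l x.1 x.2)
    (hr : PC fun x : α × ℕ => r x.1 x.2) (hv : PC v) :
    PC fun a => upper (dat a) (k a) (i a) (l a) (r a) (v a) := by
  classical
  refine PC.ite ((hv.div hk).eq hi) (PC.subst CtxMap.id hr hv) (PC.sup pc_order ?_)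
  exact PC.ite (((PC.snd.div hk.fst).eq hi.fst).and (pc_adj hv.fst PC.snd)) hl (PC.const 0)

lemma pc_lower (hk : PC k) (hi : PC i) (hl : PC fun x : α × ℕ => l x.1 x.2)
    (hr : PC fun x : α × ℕ => r x.1 x.2) (hv : PC v) :
    PC fun a => lower (dat a) (k a) (i a) (l a) (r a) (v a) := by
  classical
  have hB := ((PC.const 2).mul hk).add (PC.const 1)
  refine PC.ite ((hv.div hk).eq hi) (PC.subst CtxMap.id hl hv) (hB.sub (PC.sup pc_order ?_))
  exact PC.ite (((PC.snd.div hk.fst).eq hi.fst).and (pc_adj hv.fst PC.snd)) (hB.fst.sub hr)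
    (PC.const 0)

lemma pc_isCode (hi : PC i) (he : PC e) (hc : PC c) :
    PCP fun a => IsCode (dat a) (i a) (e a) (c a) := by
  have hk : PC fun a : α => blockSize (order a) := pc_blockSize
  refine PCP.forall_lt pc_order (((PC.snd.div hk.fst).eq hi.fst).imp
    ((PCP.forall_lt he.fst ?_).and (PCP.forall_lt pc_order
      ((PC.snd.ne PC.snd.fst).imp (((pc_adj PC.snd.fst PC.snd).imp
        (((PC.snd.div hk.fst.fst).eq hi.fst.fst).imp (PCP.forall_lt he.fst.fst ?_))).and
        ((pc_adj PC.snd.fst PC.snd).not.imp (PCP.exists_lt he.fst.fst (PCP.or ?_ ?_))))))))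
  · exact (pc_codeLeft hk.fst.fst hc.fst.fst PC.snd PC.snd.fst).le
      (pc_codeRight hk.fst.fst hc.fst.fst PC.snd PC.snd.fst)
  · exact (pc_codeLeft hk.fst.fst.fst hc.fst.fst.fst PC.snd PC.snd.fst.fst).le
      (pc_codeRight hk.fst.fst.fst hc.fst.fst.fst PC.snd PC.snd.fst)
  · exact (pc_upper hk.fst.fst.fst hi.fst.fst.fst
      (pc_codeLeft hk.fst.fst.fst.fst hc.fst.fst.fst.fst PC.snd.fst PC.snd)
      (pc_codeRight hk.fst.fst.fst.fst hc.fst.fst.fst.fst PC.snd.fst PC.snd) PC.snd.fst).lt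
      (pc_codeLeft hk.fst.fst.fst hc.fst.fst.fst PC.snd PC.snd.fst.fst)
  · exact (pc_codeRight hk.fst.fst.fst hc.fst.fst.fst PC.snd PC.snd.fst.fst).lt
      (pc_lower hk.fst.fst.fst hi.fst.fst.fst
      (pc_codeLeft hk.fst.fst.fst.fst hc.fst.fst.fst.fst PC.snd.fst PC.snd)
      (pc_codeRight hk.fst.fst.fst.fst hc.fst.fst.fst.fst PC.snd.fst PC.snd) PC.snd.fst)

lemma pc_numFamilies : PC fun a : α => numFamilies (dat a) :=
  pc_leastBelow pc_blockSize (PCP.forall_lt pc_numBlocks (PCP.exists_lt (pc_order.pow_const 8)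
    (pc_isCode PC.snd.fst PC.snd.fst.fst PC.snd)))

lemma pc_codeOf (hi : PC i) : PC fun a : α => codeOf (dat a) (i a) :=
  pc_leastBelow (pc_order.pow_const 8) (pc_isCode hi.fst pc_numFamilies.fst PC.snd)

variable {h o : α → ℕ}

lemma pc_boxLeft (hk : PC k) (hi : PC i) (hl : PC fun x : α × ℕ => l x.1 x.2)
    (hr : PC fun x : α × ℕ => r x.1 x.2) (ho : PC o) (hv : PC v) :
    PC fun a => boxLeft (dat a) (k a) (i a) (l a) (r a) (o a) (v a) :=
  PC.ite (ho.eq (PC.const 0)) (PC.ite ((hv.div hk).eq hi) (PC.subst CtxMap.id hl hv) (PC.const 0))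
    (pc_lower hk hi hl hr hv)

lemma pc_boxRight (hk : PC k) (hi : PC i) (hl : PC fun x : α × ℕ => l x.1 x.2)
    (hr : PC fun x : α × ℕ => r x.1 x.2) (ho : PC o) (hv : PC v) :
    PC fun a => boxRight (dat a) (k a) (i a) (l a) (r a) (o a) (v a) :=
  PC.ite (ho.eq (PC.const 0)) (pc_upper hk hi hl hr hv)
    (PC.ite ((hv.div hk).eq hi) (PC.subst CtxMap.id hr hv)
      (((PC.const 2).mul hk).add (PC.const 1)))

lemma pc_cubeNum (hk : PC k) (hi : PC i) (hl : PC fun x : α × ℕ => l x.1 x.2)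
    (hr : PC fun x : α × ℕ => r x.1 x.2) (hh : PC h) (ho : PC o) (hv : PC v) :
    PC fun a => cubeNum (dat a) (k a) (i a) (l a) (r a) (h a) (o a) (v a) := by
  have hlabel : PC fun a => label (k a) (i a) (v a) :=
    PC.ite ((hv.div hk).eq hi) (hv.mod hk) hk
  refine PC.ite (PC.eq ?_ ho) (pc_upper hk hi hl hr hv)
    ((((PC.const 2).mul hk).add (PC.const 1)).add (pc_lower hk hi hl hr hv))
  exact (hlabel.div (PC.min_pow (pc_order.add (PC.const 1)) (PC.const 2) hh)).mod (PC.const 2)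

end Computability

section Correctness

lemma codeLeft_le (n k c j a : ℕ) : codeLeft n k c j a ≤ 2 * k + 1 :=
  (Nat.mod_lt _ (Nat.succ_pos _)).le

lemma codeRight_le (n k c j a : ℕ) : codeRight n k c j a ≤ 2 * k + 1 :=
  (Nat.mod_lt _ (Nat.succ_pos _)).le

lemma blockSize_le (n : ℕ) : blockSize n ≤ n := Nat.findGreatest_le n

lemma blockSize_pow_le {n : ℕ} (hn : 0 < n) :
    (2 * blockSize n + 1) ^ (2 * blockSize n * blockSize n) ≤ n ^ 8 := by
  have h := Nat.findGreatest_spec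
    (P := fun j => min (n ^ 8 + 1) ((2 * j + 1) ^ (2 * j * j)) ≤ n ^ 8) (Nat.zero_le n)
    (by simpa using Nat.one_le_pow _ _ hn)
  change min (n ^ 8 + 1) _ ≤ n ^ 8 at h
  change (2 * blockSize n + 1) ^ (2 * blockSize n * blockSize n) ≤ n ^ 8
  rw [blockSize]
  omega

lemma le_blockSize {n j : ℕ} (hj : j ≤ n) (h : (2 * j + 1) ^ (2 * j * j) ≤ n ^ 8) :
    j ≤ blockSize n :=
  Nat.le_findGreatest hj ((min_le_right _ _).trans h)

lemma blockSize_pos {n : ℕ} (hn : 2 ≤ n) : 0 < blockSize n := by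
  refine le_blockSize (by omega) ?_
  calc (2 * 1 + 1) ^ (2 * 1 * 1) ≤ 2 ^ 8 := by norm_num
    _ ≤ n ^ 8 := Nat.pow_le_pow_left hn 8

lemma le_numBlocks_mul {n : ℕ} (hn : 2 ≤ n) : n ≤ numBlocks n * blockSize n := by
  have hk := blockSize_pos hn
  have h := Nat.lt_div_mul_add (a := n + blockSize n - 1) hk
  rw [numBlocks]
  omega

lemma lt_two_pow_numBits (n : ℕ) : blockSize n < 2 ^ numBits n := by
  by_contra! h
  -- Since `q < 2 ^ q`, a counterexample would lie within the range of the search.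
  have h₁ : numBits n ≤ blockSize n := Nat.lt_two_pow_self.le.trans h
  have h₂ := Nat.findGreatest_is_greatest
    (P := fun j => min (n + 1) (2 ^ j) ≤ blockSize n) (k := numBits n) (Nat.lt_succ_self _) h₁
  exact h₂ ((min_le_right _ _).trans h)

lemma two_pow_numBits_le {n : ℕ} (hn : 2 ≤ n) : 2 ^ (numBits n - 1) ≤ blockSize n := by
  have hk := blockSize_pos hn
  have h := Nat.findGreatest_spec (P := fun j => min (n + 1) (2 ^ j) ≤ blockSize n)
    (Nat.zero_le (blockSize n)) ((min_le_right _ _).trans ((pow_zero 2).trans_le hk))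
  have hle := blockSize_le n
  change min (n + 1) (2 ^ (numBits n - 1)) ≤ blockSize n at h
  omega

/-- All families of small intervals have codes. -/
lemma exists_code {n k : ℕ} (hk : 0 < k) (hpow : (2 * k + 1) ^ (2 * k * k) ≤ n ^ 8) (i : ℕ)
    {e : ℕ} (he : e ≤ k) {l r : ℕ → ℕ → ℕ} (hl : ∀ j a, l j a ≤ 2 * k)
    (hr : ∀ j a, r j a ≤ 2 * k) : ∃ c < n ^ 8, ∀ j < e, ∀ a, a / k = i →
      l j a = codeLeft n k c j a ∧ r j a = codeRight n k c j a := by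
  -- Left end points are stored at even places, right ones at odd places; half the place is `j * k`
  -- plus the residue of the vertex.
  let f : Fin (2 * k * k) → Fin (2 * k + 1) := fun x =>
    if x.1 % 2 = 0 then ⟨l (x.1 / 2 / k) (k * i + x.1 / 2 % k), Nat.lt_succ_of_le (hl _ _)⟩
    else ⟨r (x.1 / 2 / k) (k * i + x.1 / 2 % k), Nat.lt_succ_of_le (hr _ _)⟩
  refine ⟨finFunctionFinEquiv f, (Fin.is_lt _).trans_le hpow, fun j hj a ha => ?_⟩
  have hdig : ∀ x : Fin (2 * k * k), digit n k (finFunctionFinEquiv f) x = f x := by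
    intro x
    have h₁ : (2 * k + 1) ^ (x : ℕ) ≤ n ^ 8 :=
      (Nat.pow_le_pow_right (Nat.succ_pos _) x.2.le).trans hpow
    rw [digit, min_eq_right h₁, ← finFunctionFinEquiv_symm_apply_val, Equiv.symm_apply_apply]
  have hmod := Nat.mod_lt a hk
  have hjk : j * k + a % k < k * k := by
    have : (j + 1) * k ≤ k * k := Nat.mul_le_mul_right k (by omega)
    rw [add_mul] at this
    omega
  have h₁ : (j * k + a % k) / k = j := by
    rw [mul_comm, Nat.mul_add_div hk, Nat.div_eq_of_lt hmod, add_zero]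
  have h₂ : (j * k + a % k) % k = a % k := by
    rw [mul_comm, Nat.mul_add_mod, Nat.mod_mod]
  have h₃ : k * i + a % k = a := by rw [← ha, Nat.div_add_mod]
  have hkk : 2 * k * k = 2 * (k * k) := mul_assoc _ _ _
  constructor
  · have := hdig ⟨(j * k + a % k) * 2, by omega⟩
    rw [codeLeft, this]
    simp [f, h₁, h₂, h₃]
  · have := hdig ⟨(j * k + a % k) * 2 + 1, by omega⟩
    have e₁ : ((j * k + a % k) * 2 + 1) / 2 = j * k + a % k := by omega
    have e₂ : ((j * k + a % k) * 2 + 1) % 2 = 1 := by omega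
    rw [codeRight, this]
    simp [f, h₁, h₂, h₃, e₁, e₂]

variable (D : Dat)

/-- The default value of the search, `blockSize D.1` families, works by `exists_separates_self`, so
the search always succeeds. -/
lemma exists_isCode_numFamilies (hn : 2 ≤ D.1) : ∀ i < numBlocks D.1,
    ∃ c < D.1 ^ 8, IsCode D i (numFamilies D) c := by
  refine leastBelow_spec (P := fun e => ∀ i < numBlocks D.1, ∃ c < D.1 ^ 8, IsCode D i e c)
    fun i _ => ?_
  obtain ⟨l, r, hl, hr, h⟩ := exists_separates_self D (blockSize D.1) i (blockSize_pos hn)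
  obtain ⟨c, hc, h'⟩ := exists_code (blockSize_pos hn) (blockSize_pow_le (by omega)) i le_rfl hl hr
  exact ⟨c, hc, h.congr h'⟩

lemma isCode_codeOf (hn : 2 ≤ D.1) {i : ℕ} (hi : i < numBlocks D.1) :
    IsCode D i (numFamilies D) (codeOf D i) :=
  leastBelow_spec_of_lt (exists_isCode_numFamilies D hn i hi)

lemma numFamilies_le_of_boxes (hn : 2 ≤ D.1) {e : ℕ} {l r : ℕ → ℕ → ℝ}
    (hlr : ∀ j < e, ∀ v, l j v ≤ r j v)
    (h : ∀ u < D.1, ∀ v < D.1, adj D u v ↔ u ≠ v ∧ ∀ j < e, l j u ≤ r j v ∧ l j v ≤ r j u) :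
    numFamilies D ≤ e := by
  rcases le_or_gt e (blockSize D.1) with he | he
  · refine leastBelow_le_of fun i _ => ?_
    obtain ⟨l', r', hl, hr, h⟩ := exists_separates_of_boxes (blockSize_pos hn) i hlr h
    obtain ⟨c, hc, h'⟩ := exists_code (blockSize_pos hn) (blockSize_pow_le (by omega)) i he hl hr
    exact ⟨c, hc, h.congr h'⟩
  -- More than `blockSize D.1` families need no codes, as the search never exceeds that number.
  · exact (leastBelow_le _ _).trans he.le

end Correctness

end Boxicity

/-! ### Representations as systems of inequalities between end points -/

namespace Boxicity

open Ctx

section Representations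

variable {V : Type*}

lemma intervalGraph_adj {l r : V → ℝ} (h : ∀ v, l v ≤ r v) (u v : V) :
    (intervalGraph l r).Adj u v ↔ u ≠ v ∧ l u ≤ r v ∧ l v ≤ r u := by
  change u ≠ v ∧ _ ↔ _
  rw [Set.Icc_inter_Icc, Set.nonempty_Icc, sup_le_iff, le_inf_iff, le_inf_iff]
  have := h u
  have := h v
  tauto

lemma eq_iInf_intervalGraph_iff (G : SimpleGraph V) {d : ℕ} {l r : Fin d → V → ℝ}
    (h : ∀ i v, l i v ≤ r i v) : G = ⨅ i, intervalGraph (l i) (r i) ↔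
      ∀ u v, G.Adj u v ↔ u ≠ v ∧ ∀ i, l i u ≤ r i v ∧ l i v ≤ r i u := by
  have key : ∀ u v, (⨅ i, intervalGraph (l i) (r i)).Adj u v ↔
      u ≠ v ∧ ∀ i, l i u ≤ r i v ∧ l i v ≤ r i u := by
    intro u v
    simp only [SimpleGraph.iInf_adj, intervalGraph_adj (h _)]
    constructor
    · exact fun h => ⟨h.2, fun i => (h.1 i).2⟩
    · exact fun h => ⟨fun i => ⟨h.1, h.2 i⟩, h.1⟩
  constructor
  · rintro h u v
    rw [← key, ← h]
  · intro h
    ext u v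
    rw [h, key]

lemma IsCubeRepresentation.isBoxRepresentation {G : SimpleGraph V} {k : ℕ}
    {I : Fin k → SimpleGraph V} (h : IsCubeRepresentation G I) : IsBoxRepresentation G I := by
  refine ⟨fun i => ?_, h.2⟩
  obtain ⟨l, hl⟩ := h.1 i
  exact ⟨l, _, fun v => by linarith, hl⟩

/-- Guarantees that the infima defining `box` and `cub` are attained. Each ordered non-adjacent pair
is separated by placing it at `0` and `2`, with all other vertices at `1`, where they meet
everything. -/
lemma exists_isCubeRepresentation [Finite V] (G : SimpleGraph V) :
    ∃ (k : ℕ) (I : Fin k → SimpleGraph V), IsCubeRepresentation G I := by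
  classical
  have := Fintype.ofFinite V
  let S := {p : V × V // p.1 ≠ p.2 ∧ ¬ G.Adj p.1 p.2}
  let φ := (Fintype.equivFin S).symm
  let l : Fin (Fintype.card S) → V → ℝ := fun i w =>
    if w = (φ i).1.1 then 0 else if w = (φ i).1.2 then 2 else 1
  refine ⟨Fintype.card S, fun i => intervalGraph (l i) fun v => l i v + 1,
    fun i => ⟨l i, rfl⟩, (eq_iInf_intervalGraph_iff G fun i v => by linarith).2 fun u v => ?_⟩
  constructor
  · refine fun ha => ⟨ha.ne, fun i => ?_⟩
    have h₁ := (φ i).2.2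
    have h₂ : ¬ (u = (φ i).1.1 ∧ v = (φ i).1.2) := fun h => h₁ (h.1 ▸ h.2 ▸ ha)
    have h₃ : ¬ (v = (φ i).1.1 ∧ u = (φ i).1.2) := fun h => h₁ (h.1 ▸ h.2 ▸ ha.symm)
    simp only [l]
    split_ifs <;> first | (exfalso; tauto) | norm_num
  · rintro ⟨huv, h⟩
    by_contra ha
    have := (h (φ.symm ⟨(u, v), huv, ha⟩)).2
    simp only [l, Equiv.apply_symm_apply, if_true, huv.symm, if_false] at this
    norm_num at this

variable [Finite V] (G : SimpleGraph V)

lemma exists_boxes : ∃ l r : Fin (box G) → V → ℝ, (∀ i v, l i v ≤ r i v) ∧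
    ∀ u v, G.Adj u v ↔ u ≠ v ∧ ∀ i, l i u ≤ r i v ∧ l i v ≤ r i u := by
  obtain ⟨k, I, h⟩ := exists_isCubeRepresentation G
  obtain ⟨I, hI, hG⟩ : ∃ I : Fin (box G) → SimpleGraph V, IsBoxRepresentation G I :=
    Nat.sInf_mem (s := {k | ∃ I : Fin k → SimpleGraph V, IsBoxRepresentation G I})
      ⟨k, I, h.isBoxRepresentation⟩
  choose l r hlr hI using hI
  exact ⟨l, r, hlr, (eq_iInf_intervalGraph_iff G hlr).1 (by simp only [← hI]; exact hG)⟩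

lemma exists_cubes : ∃ l : Fin (cub G) → V → ℝ,
    ∀ u v, G.Adj u v ↔ u ≠ v ∧ ∀ i, l i u ≤ l i v + 1 ∧ l i v ≤ l i u + 1 := by
  obtain ⟨k, I, h⟩ := exists_isCubeRepresentation G
  obtain ⟨I, hI, hG⟩ : ∃ I : Fin (cub G) → SimpleGraph V, IsCubeRepresentation G I :=
    Nat.sInf_mem (s := {k | ∃ I : Fin k → SimpleGraph V, IsCubeRepresentation G I}) ⟨k, I, h⟩
  choose l hI using hI
  exact ⟨l, (eq_iInf_intervalGraph_iff G fun i v => by linarith).1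
    (by simp only [← hI]; exact hG)⟩

/-- The search competes with the boxicity only; this turns its bound into one by the cubicity. -/
lemma box_le_cub : box G ≤ cub G := by
  obtain ⟨k, I, h⟩ := exists_isCubeRepresentation G
  obtain ⟨I, hI⟩ := Nat.sInf_mem (s := {k | ∃ I : Fin k → SimpleGraph V,
    IsCubeRepresentation G I}) ⟨k, I, h⟩
  exact Nat.sInf_le ⟨I, hI.isBoxRepresentation⟩

end Representations

section Output

variable {n : ℕ} {G : SimpleGraph (Fin n)} {s : State} {d : ℕ}

lemma holdsBoxRepresentation_of (h0 : s.var 0 = d)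
    (hlr : ∀ i < d, ∀ v < n, s.arr 1 (i * n + v) ≤ s.arr 2 (i * n + v))
    (h : ∀ u v : Fin n, G.Adj u v ↔ u ≠ v ∧ ∀ i < d,
      s.arr 1 (i * n + u) ≤ s.arr 2 (i * n + v) ∧ s.arr 1 (i * n + v) ≤ s.arr 2 (i * n + u)) :
    HoldsBoxRepresentation G s d := by
  have hlr' : ∀ (i : Fin d) (v : Fin n),
      (s.arr 1 (i * n + v) : ℝ) ≤ (s.arr 2 (i * n + v) : ℝ) := fun i v => by
    exact_mod_cast hlr i i.2 v v.2
  refine ⟨h0, fun i v => hlr i i.2 v v.2, fun i => ⟨_, _, hlr' i, rfl⟩,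
    (eq_iInf_intervalGraph_iff G hlr').2 fun u v => ?_⟩
  rw [h]
  simp only [Nat.cast_le, Fin.forall_iff]

lemma holdsCubeRepresentation_of (h0 : s.var 0 = d) (hpos : ∀ i < d, 0 < s.arr 2 i)
    (h : ∀ u v : Fin n, G.Adj u v ↔ u ≠ v ∧ ∀ i < d,
      s.arr 1 (i * n + u) ≤ s.arr 1 (i * n + v) + s.arr 2 i ∧
      s.arr 1 (i * n + v) ≤ s.arr 1 (i * n + u) + s.arr 2 i) :
    HoldsCubeRepresentation G s d := by
  refine ⟨h0, fun i => hpos i i.2, fun i => ⟨_, rfl⟩,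
    (eq_iInf_intervalGraph_iff G fun i v => by linarith).2 fun u v => ?_⟩
  have key : ∀ i < d, ∀ a b : ℕ, (a : ℝ) / (s.arr 2 i : ℝ) ≤ (b : ℝ) / (s.arr 2 i : ℝ) + 1 ↔
      a ≤ b + s.arr 2 i := by
    intro i hi a b
    have : (0 : ℝ) < s.arr 2 i := by exact_mod_cast hpos i hi
    rw [div_add_one this.ne', div_le_div_iff_of_pos_right this]
    norm_cast
  rw [h]
  simp only [Fin.forall_iff]
  exact and_congr_right fun _ => forall₂_congr fun i hi => by rw [key i hi, key i hi]

end Output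

/-! ### Integral optimal representations and the table for small graphs -/

section Table

/-- Integer parts of a suitable multiple compare finitely many real numbers correctly. -/
lemma exists_scale {ι : Type*} [Finite ι] (f : ι → ℝ) (m : ℕ) :
    ∃ K : ℕ, 0 < K ∧ ∃ g : ι → ℕ, ∀ a b, g a ≤ g b + K * m ↔ f a ≤ f b + m := by
  obtain ⟨c, hc⟩ := (Set.finite_range f).bddBelow
  have hc : ∀ a, c ≤ f a := fun a => hc ⟨a, rfl⟩
  -- A large scale widens the gap of every failing inequality to at least one, so that integer parts
  -- cannot close it. The case `m = 0` serves boxes, `m = 1` cubes.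
  have hK : ∀ᶠ K : ℕ in Filter.atTop, ∀ a b, f b + m < f a → 1 ≤ K * (f a - f b - m) := by
    refine Filter.eventually_all.2 fun a => Filter.eventually_all.2 fun b => ?_
    by_cases h : f b + m < f a
    · filter_upwards [((tendsto_natCast_atTop_atTop (R := ℝ)).atTop_mul_const
        (show 0 < f a - f b - m by linarith)).eventually_ge_atTop 1] with K hK _ using hK
    · exact Filter.Eventually.of_forall fun K h' => absurd h' h
  obtain ⟨K, hK, hK0⟩ := (hK.and (Filter.eventually_gt_atTop 0)).exists
  have hKr : (0 : ℝ) < K := by exact_mod_cast hK0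
  refine ⟨K, hK0, fun a => ⌊K * (f a - c)⌋₊, fun a b => ?_⟩
  have hnn : ∀ a, 0 ≤ K * (f a - c) := fun a => mul_nonneg hKr.le (by linarith [hc a])
  constructor
  · intro h
    by_contra! hlt
    have h₁ := hK a b hlt
    have h₂ : ⌊K * (f b - c)⌋₊ + K * m + 1 ≤ ⌊K * (f a - c)⌋₊ := by
      refine Nat.le_floor ?_
      push_cast
      have := Nat.floor_le (hnn b)
      nlinarith
    beta_reduce at h
    omega
  · intro h
    rw [← Nat.floor_add_natCast (hnn b)]
    refine Nat.floor_le_floor ?_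
    push_cast
    nlinarith

variable {n : ℕ} (G : SimpleGraph (Fin n))

lemma mul_add_div_of_lt {i v : ℕ} (hv : v < n) : (i * n + v) / n = i := by
  rw [mul_comm, Nat.mul_add_div (Nat.zero_lt_of_lt hv), Nat.div_eq_of_lt hv, add_zero]

lemma mul_add_mod_of_lt {i v : ℕ} (hv : v < n) : (i * n + v) % n = v := by
  rw [mul_comm, Nat.mul_add_mod, Nat.mod_eq_of_lt hv]

lemma exists_tabulate {d : ℕ} (g : Fin d → Fin n → ℕ) :
    ∃ X : ℕ → ℕ, ∀ (i : Fin d) (v : Fin n), X (i * n + v) = g i v := by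
  refine ⟨fun x => if h : x / n < d ∧ x % n < n then g ⟨x / n, h.1⟩ ⟨x % n, h.2⟩ else 0,
    fun i v => ?_⟩
  simp [mul_add_div_of_lt v.2, mul_add_mod_of_lt v.2]

/-- The end points of an optimal box representation can be chosen to be natural numbers. -/
lemma exists_nat_boxes : ∃ X Y : ℕ → ℕ,
    (∀ i < box G, ∀ v < n, X (i * n + v) ≤ Y (i * n + v)) ∧
    ∀ u v : Fin n, G.Adj u v ↔ u ≠ v ∧ ∀ i < box G,
      X (i * n + u) ≤ Y (i * n + v) ∧ X (i * n + v) ≤ Y (i * n + u) := by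
  obtain ⟨l, r, hlr, h⟩ := exists_boxes G
  obtain ⟨K, -, g, hg⟩ := exists_scale
    (fun x : Bool × Fin (box G) × Fin n => if x.1 then l x.2.1 x.2.2 else r x.2.1 x.2.2) 0
  have hg' : ∀ i j u v, g (true, i, u) ≤ g (false, j, v) ↔ l i u ≤ r j v := fun i j u v => by
    simpa using hg (true, i, u) (false, j, v)
  obtain ⟨X, hX⟩ := exists_tabulate fun i v => g (true, i, v)
  obtain ⟨Y, hY⟩ := exists_tabulate fun i v => g (false, i, v)
  refine ⟨X, Y, fun i hi v hv => ?_, fun u v => ?_⟩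
  · rw [hX ⟨i, hi⟩ ⟨v, hv⟩, hY ⟨i, hi⟩ ⟨v, hv⟩, hg']
    exact hlr _ _
  · rw [h]
    refine and_congr_right fun _ => ?_
    rw [Fin.forall_iff]
    refine forall₂_congr fun i hi => ?_
    rw [hX ⟨i, hi⟩ u, hY ⟨i, hi⟩ u, hX ⟨i, hi⟩ v, hY ⟨i, hi⟩ v, hg', hg']

/-- The left end points of an optimal cube representation can be chosen to be rational numbers. -/
lemma exists_nat_cubes : ∃ (X : ℕ → ℕ) (K : ℕ), 0 < K ∧
    ∀ u v : Fin n, G.Adj u v ↔ u ≠ v ∧ ∀ i < cub G,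
      X (i * n + u) ≤ X (i * n + v) + K ∧ X (i * n + v) ≤ X (i * n + u) + K := by
  obtain ⟨l, h⟩ := exists_cubes G
  obtain ⟨K, hK, g, hg⟩ := exists_scale (fun x : Fin (cub G) × Fin n => l x.1 x.2) 1
  have hg' : ∀ i j u v, g (i, u) ≤ g (j, v) + K ↔ l i u ≤ l j v + 1 := fun i j u v => by
    simpa using hg (i, u) (j, v)
  obtain ⟨X, hX⟩ := exists_tabulate fun i v => g (i, v)
  refine ⟨X, K, hK, fun u v => ?_⟩
  rw [h]
  refine and_congr_right fun _ => ?_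
  rw [Fin.forall_iff]
  refine forall₂_congr fun i hi => ?_
  rw [hX ⟨i, hi⟩ u, hX ⟨i, hi⟩ v, hg', hg']

/-- A program that looks up the output for graphs with less than `N` vertices, and computes it for
all others. -/
theorem exists_exec_table (N : ℕ) (d₀ : Dat → ℕ) (X₀ Y₀ : Dat → ℕ → ℕ) {d : Dat → ℕ}
    {X Y : Dat × ℕ → ℕ} (hd : PC d) (hX : PC X) (hY : PC Y) :
    ∃ (p : Prog) (T : Polynomial ℕ), ∀ D : Dat, ∃ (s : State) (t : ℕ),
      Exec p (input D.2) s t ∧ t ≤ T.eval D.1 ∧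
      (D.1 < N → s.var 0 = d₀ D ∧
        ∀ x < d₀ D * (D.1 + 1), s.arr 1 x = X₀ D x ∧ s.arr 2 x = Y₀ D x) ∧
      (N ≤ D.1 → s.var 0 = d D ∧
        ∀ x < d D * (D.1 + 1), s.arr 1 x = X (D, x) ∧ s.arr 2 x = Y (D, x)) := by
  classical
  let S : Finset Dat := (Finset.range N).sigma fun n => Finset.univ
  have hS : ∀ D : Dat, D.1 < N → D ∈ S := fun D hD => by simpa [S] using hD
  -- With `D.1 + 1` in place of `D.1`, the cells include both the end points and, in a cube
  -- representation, one denominator per dimension, even for the empty graph.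
  let m := S.sup fun D => d₀ D * (D.1 + 1)
  have hm : ∀ D ∈ S, d₀ D * (D.1 + 1) ≤ m := fun D hD =>
    Finset.le_sup (f := fun D => d₀ D * (D.1 + 1)) hD
  have hd' := PC.ite (pc_order.lt (PC.const N)) (PC.table S 1 (fun D _ => d₀ D) (PC.const 0)) hd
  have hX' := PC.ite (pc_order.lt (PC.const N)) (PC.table S m X₀ PC.snd) hX
  have hY' := PC.ite (pc_order.lt (PC.const N)) (PC.table S m Y₀ PC.snd) hY
  obtain ⟨p, T, hp⟩ := exists_exec_output hd' (hd'.mul (pc_order.add (PC.const 1))) hX' hY'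
  refine ⟨p, T, fun D => ?_⟩
  obtain ⟨s, t, h, ht, h0, hx⟩ := hp D
  refine ⟨s, t, h, ht, fun hD => ?_, fun hD => ?_⟩
  · have hDS := hS D hD
    have e : ∀ y, (D ∈ S ∧ y < m) = (y < m) := fun y => by simp [hDS]
    simp only [order_dat, order_prod, hD, if_true, dat_prod, show dat D = D from rfl, e] at h0 hx
    simp only [hDS, true_and, zero_lt_one, if_true] at h0 hx
    refine ⟨h0, fun x hxd => ?_⟩
    have := hx x hxd
    rwa [if_pos (hxd.trans_le (hm D hDS)), if_pos (hxd.trans_le (hm D hDS))] at this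
  · simp only [order_dat, order_prod, hD.not_gt, if_false] at h0 hx
    exact ⟨h0, hx⟩

end Table

end Boxicity

/-! ### Asymptotic estimates -/

namespace Boxicity

lemma numBlocks_le {n m : ℕ} (hk : 0 < blockSize n) (h : n ≤ m * blockSize n) :
    numBlocks n ≤ m := by
  rw [numBlocks, ← Nat.lt_add_one_iff, Nat.div_lt_iff_lt_mul hk, add_mul]
  omega

lemma numBlocks_le_add_one {n : ℕ} (hk : 0 < blockSize n) :
    (numBlocks n : ℝ) ≤ n / blockSize n + 1 := by
  have h : numBlocks n ≤ n / blockSize n + 1 := by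
    refine numBlocks_le hk ?_
    have := Nat.lt_div_mul_add (a := n) hk
    rw [add_mul]
    omega
  calc (numBlocks n : ℝ) ≤ ((n / blockSize n + 1 : ℕ) : ℝ) := by exact_mod_cast h
    _ ≤ n / blockSize n + 1 := by
      push_cast
      gcongr
      exact Nat.cast_div_le


lemma log_pos_of_log_log {n : ℕ} (hx : 100 ≤ Real.log (Real.log n)) :
    0 < Real.log n ∧ Real.log (Real.log n) ≤ Real.log n ∧ Real.log n ≤ n ∧ 2 ≤ n := by
  have hn : n ≠ 0 := by
    rintro rfl
    norm_num at hx
  have h0 : 0 ≤ Real.log n := Real.log_natCast_nonneg n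
  have h1 : 0 < Real.log n := h0.lt_of_ne fun h => by
    rw [← h] at hx
    norm_num at hx
  refine ⟨h1, Real.log_le_self h0, Real.log_le_self (Nat.cast_nonneg n), ?_⟩
  by_contra! h
  obtain rfl : n = 1 := by omega
  simp at h1

/-- The blocks are large. -/
lemma le_blockSize_of_log_log {n : ℕ} (hx : 100 ≤ Real.log (Real.log n)) :
    2 * √(Real.log n / Real.log (Real.log n)) ≤ blockSize n := by
  obtain ⟨hy0, hxy, -, hn⟩ := log_pos_of_log_log hx
  have hn0 : (0 : ℝ) < n := by positivity
  have hey : Real.exp (Real.log n) = n := Real.exp_log hn0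
  have hex : Real.exp (Real.log (Real.log n)) = Real.log n := Real.exp_log hy0
  set y := Real.log n with hy
  set x := Real.log y with hxdef
  set s := √(y / x) with hs
  have hx0 : 0 < x := by linarith
  have hss : s * s = y / x := Real.mul_self_sqrt (by positivity)
  have hssx : s * s * x = y := by rw [hss]; field_simp
  have hs0 : 0 ≤ s := Real.sqrt_nonneg _
  have hs5 : 5 ≤ s := by
    have h1 := Real.quadratic_le_exp_of_nonneg hx0.le
    rw [hex] at h1
    by_contra! h
    have h2 : s * s ≤ 25 := by nlinarith
    have h3 : y ≤ 25 * x := hssx ▸ mul_le_mul_of_nonneg_right h2 hx0.le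
    nlinarith
  have hsy : s ≤ √y := Real.sqrt_le_sqrt (div_le_self hy0.le (by linarith))
  have hlogs : Real.log s ≤ x / 2 := by
    rw [hxdef, ← Real.log_sqrt hy0.le]
    exact Real.log_le_log (by linarith) hsy
  set κ := ⌈2 * s⌉₊ with hκ
  have hκ1 : (κ : ℝ) ≤ 2 * s + 1 := (Nat.ceil_lt_add_one (by positivity)).le
  refine (Nat.le_ceil (2 * s)).trans ?_
  rw [← hκ]
  norm_cast
  refine le_blockSize ?_ ?_
  · have h1 := Real.quadratic_le_exp_of_nonneg hy0.le
    rw [hey] at h1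
    have h2 : s ≤ y := by nlinarith
    have : (κ : ℝ) ≤ n := by nlinarith
    exact_mod_cast this
  -- Here `2 * κ + 1 ≤ 4 * s + 3 ≤ 5 * s`, and `log 5 ≤ 4` is absorbed by `3 / 10 * x`.
  · have hlog : Real.log (2 * κ + 1) ≤ 4 / 5 * x := by
      calc Real.log (2 * κ + 1) ≤ Real.log (5 * s) :=
            Real.log_le_log (by positivity) (by linarith)
        _ = Real.log 5 + Real.log s := Real.log_mul (by norm_num) (by linarith)
        _ ≤ 4 / 5 * x := by
          have := Real.log_le_sub_one_of_pos (x := 5) (by norm_num)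
          linarith
    have hlog0 : 0 ≤ Real.log (2 * κ + 1) := Real.log_nonneg (by
      have : (0 : ℝ) ≤ κ := Nat.cast_nonneg κ
      linarith)
    -- From `s ≥ 5` follows `(2 * s + 1) ^ 2 ≤ 5 * s ^ 2`.
    have hκκ : (κ : ℝ) * κ ≤ 5 * (s * s) := by
      have : (0 : ℝ) ≤ κ := Nat.cast_nonneg κ
      nlinarith
    -- The product `2 * 5 * (4 / 5) = 8` accounts for the exponent in `n ^ 8`.
    have key : (2 * κ * κ : ℝ) * Real.log (2 * κ + 1) ≤ 8 * y := by
      calc (2 * κ * κ : ℝ) * Real.log (2 * κ + 1)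
          ≤ (2 * (5 * (s * s))) * (4 / 5 * x) := by
            refine mul_le_mul ?_ hlog hlog0 (by positivity)
            linarith
        _ = 8 * (s * s * x) := by ring
        _ = 8 * y := by rw [hssx]
    have : ((2 * κ + 1 : ℝ)) ^ (2 * κ * κ) ≤ (n : ℝ) ^ 8 := by
      rw [← Real.log_le_log_iff (by positivity) (by positivity), Real.log_pow, Real.log_pow]
      push_cast
      exact key
    exact_mod_cast this

/-- The labels have few digits. -/
lemma numBits_le_of_log_log {n : ℕ} (hx : 100 ≤ Real.log (Real.log n)) :
    (numBits n : ℝ) ≤ 4 / 5 * Real.log (Real.log n) := by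
  obtain ⟨hy0, -, -, hn⟩ := log_pos_of_log_log hx
  have hk := blockSize_pos hn
  have h1 := blockSize_pow_le (n := n) (by omega)
  have h2 := two_pow_numBits_le hn
  have hl2 := Real.log_two_gt_d9
  set k := blockSize n with hkdef
  have hk0 : (0 : ℝ) < k := by exact_mod_cast hk
  have h3 : (2 : ℝ) ^ (2 * k * k) ≤ (n : ℝ) ^ 8 := by
    have : 2 ^ (2 * k * k) ≤ n ^ 8 := (Nat.pow_le_pow_left (by omega) _).trans h1
    exact_mod_cast this
  have h4 := Real.log_le_log (by positivity) h3
  rw [Real.log_pow, Real.log_pow] at h4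
  push_cast at h4
  have h5 : (k : ℝ) * k ≤ 8 * Real.log n := by nlinarith [mul_pos hk0 hk0]
  have h6 := Real.log_le_log (by positivity) h5
  rw [Real.log_mul hk0.ne' hk0.ne', Real.log_mul (by norm_num) hy0.ne'] at h6
  have h7 : Real.log 8 ≤ 7 := by
    have := Real.log_le_sub_one_of_pos (x := 8) (by norm_num)
    linarith
  have h8 : (2 : ℝ) ^ (numBits n - 1) ≤ k := by exact_mod_cast h2
  have h9 := Real.log_le_log (by positivity) h8
  rw [Real.log_pow] at h9
  have hq : 1 ≤ numBits n := Nat.le_add_left 1 _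
  push_cast [Nat.cast_sub hq] at h9
  -- Together, `(numBits n - 1) * log 2 ≤ (7 + log log n) / 2`. As `1 / (2 * log 2) < 0.73`, the
  -- factor `4 / 5` leaves room for the constants once `log log n ≥ 100`.
  by_contra! h
  nlinarith

theorem numBlocks_le_ceil {n : ℕ} (hx : 100 ≤ Real.log (Real.log n)) :
    numBlocks n ≤ ⌈(n : ℝ) * √(Real.log (Real.log n)) / √(Real.log n)⌉₊ := by
  obtain ⟨hy0, -, -, hn⟩ := log_pos_of_log_log hx
  have hk := le_blockSize_of_log_log hx
  refine numBlocks_le (blockSize_pos hn) ?_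
  have h := Nat.le_ceil ((n : ℝ) * √(Real.log (Real.log n)) / √(Real.log n))
  set m := ⌈(n : ℝ) * √(Real.log (Real.log n)) / √(Real.log n)⌉₊
  rw [Real.sqrt_div hy0.le] at hk
  have h1 : 0 < √(Real.log n) := Real.sqrt_pos.2 hy0
  have h2 : 0 < √(Real.log (Real.log n)) := Real.sqrt_pos.2 (by linarith)
  have h3 : √(Real.log n) / √(Real.log (Real.log n)) ≤ blockSize n := by
    have : 0 < √(Real.log n) / √(Real.log (Real.log n)) := by positivity
    linarith
  have : (n : ℝ) ≤ m * blockSize n := by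
    calc (n : ℝ) = (n : ℝ) * √(Real.log (Real.log n)) / √(Real.log n) *
          (√(Real.log n) / √(Real.log (Real.log n))) := by field_simp
      _ ≤ m * blockSize n := by gcongr
  exact_mod_cast this

/-- The factor `2` in `le_blockSize_of_log_log` pays for rounding up the number of blocks: with `z =
n * √x / √y ≥ 10`, one has `(z / 2 + 1) * (4 / 5) ≤ z`. -/
theorem numBlocks_mul_numBits_le_ceil {n : ℕ} (hx : 100 ≤ Real.log (Real.log n)) :
    numBlocks n * numBits n ≤
      ⌈(n : ℝ) * Real.log (Real.log n) ^ (3 / 2 : ℝ) / √(Real.log n)⌉₊ := by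
  obtain ⟨hy0, hxy, hyn, hn⟩ := log_pos_of_log_log hx
  have hk := le_blockSize_of_log_log hx
  have hq := numBits_le_of_log_log hx
  have ht := numBlocks_le_add_one (blockSize_pos hn)
  have hpow : Real.log (Real.log n) ^ (3 / 2 : ℝ) =
      Real.log (Real.log n) * √(Real.log (Real.log n)) := by
    rw [Real.sqrt_eq_rpow, show (3 / 2 : ℝ) = 1 + 1 / 2 by norm_num,
      Real.rpow_add (by linarith), Real.rpow_one]
  rw [Real.sqrt_div hy0.le] at hk
  rw [hpow]
  set y := Real.log n
  set x := Real.log y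
  have hn0 : (0 : ℝ) < n := by linarith
  have h1 : 0 < √y := Real.sqrt_pos.2 hy0
  have h2 : 10 ≤ √x := Real.le_sqrt_of_sq_le (by linarith)
  have h3 : √y ≤ n := (Real.sqrt_le_iff.2 ⟨hy0.le, by nlinarith⟩).trans hyn
  have h4 : (n : ℝ) / blockSize n ≤ n * √x / √y / 2 := by
    have : (n : ℝ) / blockSize n ≤ n / (2 * (√y / √x)) := by gcongr
    refine this.trans_eq ?_
    field_simp
  have h5 : 10 ≤ n * √x / √y := by
    rw [le_div_iff₀ h1]
    nlinarith
  have : ((numBlocks n * numBits n : ℕ) : ℝ) ≤ n * (x * √x) / √y := by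
    push_cast
    calc (numBlocks n : ℝ) * numBits n ≤ (n * √x / √y / 2 + 1) * (4 / 5 * x) := by
          refine mul_le_mul (by linarith) hq (Nat.cast_nonneg _) (by positivity)
      _ ≤ (n * √x / √y) * x := by nlinarith
      _ = n * (x * √x) / √y := by ring
  exact_mod_cast this.trans (Nat.le_ceil _)

lemma eventually_log_log : ∃ N : ℕ, 3 ≤ N ∧ ∀ n ≥ N, 100 ≤ Real.log (Real.log (n : ℝ)) := by
  have h := (Real.tendsto_log_atTop.comp (Real.tendsto_log_atTop.comp
    (tendsto_natCast_atTop_atTop (R := ℝ)))).eventually_ge_atTop 100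
  obtain ⟨N, hN⟩ := Filter.eventually_atTop.1 h
  exact ⟨max N 3, le_max_right _ _, fun n hn => hN n ((le_max_left _ _).trans hn)⟩

lemma log_log_pos {n : ℕ} (hn : 3 ≤ n) : 0 < Real.log (Real.log n) ∧ 0 < Real.log n := by
  have h1 : 1 < Real.log n := by
    rw [Real.lt_log_iff_exp_lt (by positivity)]
    have : (3 : ℝ) ≤ n := by exact_mod_cast hn
    linarith [Real.exp_one_lt_d9]
  exact ⟨Real.log_pos h1, by linarith⟩

lemma one_le_ceil_box {n : ℕ} (hn : 3 ≤ n) :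
    1 ≤ ⌈(n : ℝ) * √(Real.log (Real.log n)) / √(Real.log n)⌉₊ := by
  obtain ⟨h1, h2⟩ := log_log_pos hn
  exact Nat.ceil_pos.2 (by positivity)

lemma one_le_ceil_cub {n : ℕ} (hn : 3 ≤ n) :
    1 ≤ ⌈(n : ℝ) * Real.log (Real.log n) ^ (3 / 2 : ℝ) / √(Real.log n)⌉₊ := by
  obtain ⟨h1, h2⟩ := log_log_pos hn
  exact Nat.ceil_pos.2 (by positivity)

end Boxicity

/-! ### Assembling the representations and the programs -/

namespace Boxicity

open Ctx

/-- The output numbers its interval graphs by one index in mixed radix; this splits off one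
component at a time. -/
lemma forall_lt_mul_iff {a b : ℕ} {Q : ℕ → ℕ → Prop} :
    (∀ y < a * b, Q (y / b) (y % b)) ↔ ∀ i < a, ∀ j < b, Q i j := by
  constructor
  · intro h i hi j hj
    have hlt : i * b + j < a * b := by
      have := Nat.mul_le_mul_right b (Nat.succ_le_of_lt hi)
      rw [Nat.succ_mul] at this
      omega
    have := h _ hlt
    rwa [mul_add_div_of_lt hj, mul_add_mod_of_lt hj] at this
  · intro h y hy
    have hb : 0 < b := Nat.pos_of_ne_zero fun h => by simp [h] at hy
    exact h _ ((Nat.div_lt_iff_lt_mul hb).2 hy) _ (Nat.mod_lt _ hb)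

lemma numFamilies_le_box (D : Dat) (hn : 2 ≤ D.1) : numFamilies D ≤ box D.2 := by
  obtain ⟨l, r, hlr, h⟩ := exists_boxes D.2
  let ext : (Fin (box D.2) → Fin D.1 → ℝ) → ℕ → ℕ → ℝ := fun f j v =>
    if h : j < box D.2 ∧ v < D.1 then f ⟨j, h.1⟩ ⟨v, h.2⟩ else 0
  have hext : ∀ f j v (hj : j < box D.2) (hv : v < D.1), ext f j v = f ⟨j, hj⟩ ⟨v, hv⟩ :=
    fun f j v hj hv => dif_pos ⟨hj, hv⟩
  refine numFamilies_le_of_boxes D hn (l := ext l) (r := ext r) (fun j _ v => ?_)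
    fun u hu v hv => ?_
  · simp only [ext]
    split_ifs
    · exact hlr _ _
    · exact le_rfl
  · have : adj D u v ↔ D.2.Adj ⟨u, hu⟩ ⟨v, hv⟩ := by simp [adj, hu, hv]
    rw [this, h, Fin.forall_iff, ne_eq, Fin.mk.injEq]
    refine and_congr_right fun _ => forall₂_congr fun j hj => ?_
    rw [hext l j u hj hu, hext l j v hj hv, hext r j u hj hu, hext r j v hj hv]

/-- The dimension of the box representation. -/
noncomputable def boxDim (D : Dat) : ℕ := numBlocks D.1 * numFamilies D * 2

/-- An end point of the box representation, where `f` is `boxLeft` or `boxRight`; cell `x` belongs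
to the interval graph `x / n` and to the vertex `x % n`. -/
noncomputable def boxCell (f : Dat → ℕ → ℕ → (ℕ → ℕ) → (ℕ → ℕ) → ℕ → ℕ → ℕ) (D : Dat) (y v : ℕ) :
    ℕ :=
  f D (blockSize D.1) (y / 2 / numFamilies D)
    (codeLeft D.1 (blockSize D.1) (codeOf D (y / 2 / numFamilies D)) (y / 2 % numFamilies D))
    (codeRight D.1 (blockSize D.1) (codeOf D (y / 2 / numFamilies D)) (y / 2 % numFamilies D))
    (y % 2) v

/-- The dimension of the cube representation. -/
noncomputable def cubeDim (D : Dat) : ℕ := numBlocks D.1 * numFamilies D * numBits D.1 * 2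

/-- A numerator of the cube representation. -/
noncomputable def cubeCell (D : Dat) (y v : ℕ) : ℕ :=
  cubeNum D (blockSize D.1) (y / 2 / numBits D.1 / numFamilies D)
    (codeLeft D.1 (blockSize D.1) (codeOf D (y / 2 / numBits D.1 / numFamilies D))
      (y / 2 / numBits D.1 % numFamilies D))
    (codeRight D.1 (blockSize D.1) (codeOf D (y / 2 / numBits D.1 / numFamilies D))
      (y / 2 / numBits D.1 % numFamilies D))
    (y / 2 % numBits D.1) (y % 2) v

lemma pc_boxDim : PC boxDim :=
  ((pc_numBlocks (α := Dat)).mul pc_numFamilies).mul (PC.const 2)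

lemma pc_cubeDim : PC cubeDim :=
  (((pc_numBlocks (α := Dat)).mul pc_numFamilies).mul pc_numBits).mul (PC.const 2)

lemma pc_boxCell_left : PC fun x : Dat × ℕ => boxCell boxLeft x.1 (x.2 / x.1.1) (x.2 % x.1.1) := by
  have hy : PC fun x : Dat × ℕ => x.2 / order x.1 := PC.snd.div pc_order.fst
  have he : PC fun x : Dat × ℕ => numFamilies (dat x) := pc_numFamilies
  have hi := (hy.div (PC.const 2)).div he
  have hj := (hy.div (PC.const 2)).mod he
  exact pc_boxLeft pc_blockSize hi
    (pc_codeLeft pc_blockSize (pc_codeOf hi).fst hj.fst PC.snd)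
    (pc_codeRight pc_blockSize (pc_codeOf hi).fst hj.fst PC.snd)
    (hy.mod (PC.const 2)) (PC.snd.mod pc_order.fst)

lemma pc_boxCell_right :
    PC fun x : Dat × ℕ => boxCell boxRight x.1 (x.2 / x.1.1) (x.2 % x.1.1) := by
  have hy : PC fun x : Dat × ℕ => x.2 / order x.1 := PC.snd.div pc_order.fst
  have he : PC fun x : Dat × ℕ => numFamilies (dat x) := pc_numFamilies
  have hi := (hy.div (PC.const 2)).div he
  have hj := (hy.div (PC.const 2)).mod he
  exact pc_boxRight pc_blockSize hi
    (pc_codeLeft pc_blockSize (pc_codeOf hi).fst hj.fst PC.snd)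
    (pc_codeRight pc_blockSize (pc_codeOf hi).fst hj.fst PC.snd)
    (hy.mod (PC.const 2)) (PC.snd.mod pc_order.fst)

lemma pc_cubeCell : PC fun x : Dat × ℕ => cubeCell x.1 (x.2 / x.1.1) (x.2 % x.1.1) := by
  have hy : PC fun x : Dat × ℕ => x.2 / order x.1 := PC.snd.div pc_order.fst
  have he : PC fun x : Dat × ℕ => numFamilies (dat x) := pc_numFamilies
  have hq : PC fun x : Dat × ℕ => numBits (order x) := pc_numBits
  have hz := (hy.div (PC.const 2)).div hq
  have hi := hz.div he
  have hj := hz.mod he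
  exact pc_cubeNum pc_blockSize hi
    (pc_codeLeft pc_blockSize (pc_codeOf hi).fst hj.fst PC.snd)
    (pc_codeRight pc_blockSize (pc_codeOf hi).fst hj.fst PC.snd)
    ((hy.div (PC.const 2)).mod hq) (hy.mod (PC.const 2)) (PC.snd.mod pc_order.fst)

section

variable {D : Dat}

lemma boxCell_left_le_right (hn : 2 ≤ D.1) {y v : ℕ} (hy : y < boxDim D) (hv : v < D.1) :
    boxCell boxLeft D y v ≤ boxCell boxRight D y v := by
  have he : 0 < numFamilies D := Nat.pos_of_ne_zero fun h => by simp [boxDim, h] at hy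
  have hy2 : y / 2 < numBlocks D.1 * numFamilies D := by
    rw [Nat.div_lt_iff_lt_mul two_pos]
    exact hy
  exact boxLeft_le_boxRight (isCode_codeOf D hn ((Nat.div_lt_iff_lt_mul he).2 hy2))
    (Nat.mod_lt _ he) hv

lemma adj_iff_boxCell (hn : 2 ≤ D.1) {u v : ℕ} (hu : u < D.1) (hv : v < D.1) :
    adj D u v ↔ u ≠ v ∧ ∀ y < boxDim D, boxCell boxLeft D y u ≤ boxCell boxRight D y v ∧
      boxCell boxLeft D y v ≤ boxCell boxRight D y u := by
  rw [adj_iff_boxes (fun i hi => isCode_codeOf D hn hi) (fun i j a => codeLeft_le _ _ _ _ _)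
    (blockSize_pos hn) (le_numBlocks_mul hn) hu hv]
  refine and_congr_right fun _ => ?_
  rw [boxDim, ← forall_lt_mul_iff (a := numBlocks D.1) (b := numFamilies D),
    ← forall_lt_mul_iff (b := 2)]
  rfl

lemma adj_iff_cubeCell (hn : 2 ≤ D.1) {u v : ℕ} (hu : u < D.1) (hv : v < D.1) :
    adj D u v ↔ u ≠ v ∧ ∀ y < cubeDim D,
      cubeCell D y u ≤ cubeCell D y v + (2 * blockSize D.1 + 1) ∧
      cubeCell D y v ≤ cubeCell D y u + (2 * blockSize D.1 + 1) := by
  rw [adj_iff_cubes (fun i hi => isCode_codeOf D hn hi) (fun i j a => codeLeft_le _ _ _ _ _)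
    (fun i j a => codeRight_le _ _ _ _ _) (blockSize_pos hn) (blockSize_le _)
    (le_numBlocks_mul hn) (lt_two_pow_numBits D.1) hu hv]
  refine and_congr_right fun _ => ?_
  rw [cubeDim, ← forall_lt_mul_iff (a := numBlocks D.1) (b := numFamilies D),
    ← forall_lt_mul_iff (b := numBits D.1), ← forall_lt_mul_iff (b := 2)]
  rfl

end

lemma mul_add_lt_mul {d n i v : ℕ} (hi : i < d) (hv : v < n) : i * n + v < d * (n + 1) := by
  have := Nat.mul_le_mul_right n (Nat.succ_le_of_lt hi)
  rw [Nat.succ_mul] at this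
  rw [mul_add]
  omega

lemma adj_val_iff {n : ℕ} (G : SimpleGraph (Fin n)) (u v : Fin n) :
    adj ⟨n, G⟩ u v ↔ G.Adj u v := by
  simp [adj]

end Boxicity

open Boxicity

theorem theorem2 :
    (∃ (p : Boxicity.Prog) (T : Polynomial ℕ), ∀ (n : ℕ) (G : SimpleGraph (Fin n)),
      ∃ (s : Boxicity.State) (t d : ℕ),
        Boxicity.Exec p (Boxicity.input G) s t ∧ t ≤ T.eval n ∧
        Boxicity.HoldsBoxRepresentation G s d ∧
        (3 ≤ n →
          d ≤ 2 * ⌈(n : ℝ) * √(Real.log (Real.log n)) / √(Real.log n)⌉₊ * Boxicity.box G)) ∧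
    (∃ (p : Boxicity.Prog) (T : Polynomial ℕ), ∀ (n : ℕ) (G : SimpleGraph (Fin n)),
      ∃ (s : Boxicity.State) (t d : ℕ),
        Boxicity.Exec p (Boxicity.input G) s t ∧ t ≤ T.eval n ∧
        Boxicity.HoldsCubeRepresentation G s d ∧
        (3 ≤ n →
          d ≤ 2 * ⌈(n : ℝ) * Real.log (Real.log n) ^ (3 / 2 : ℝ) / √(Real.log n)⌉₊ *
            Boxicity.cub G)) := by
  obtain ⟨N, hN3, hN⟩ := eventually_log_log
  constructor
  · choose X₀ Y₀ h₀ h₀' using fun D : Dat => exists_nat_boxes D.2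
    obtain ⟨p, T, hp⟩ := exists_exec_table N (fun D => box D.2) X₀ Y₀ pc_boxDim pc_boxCell_left
      pc_boxCell_right
    refine ⟨p, T, fun n G => ?_⟩
    obtain ⟨s, t, h, ht, h₁, h₂⟩ := hp ⟨n, G⟩
    rcases lt_or_ge n N with hnN | hnN
    · obtain ⟨h0, hx⟩ := h₁ hnN
      refine ⟨s, t, box G, h, ht, holdsBoxRepresentation_of h0 (fun i hi v hv => ?_)
        (fun u v => ?_), fun hn => ?_⟩
      · rw [(hx _ (mul_add_lt_mul hi hv)).1, (hx _ (mul_add_lt_mul hi hv)).2]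
        exact h₀ ⟨n, G⟩ i hi v hv
      · rw [h₀' ⟨n, G⟩ u v]
        refine and_congr_right fun _ => forall₂_congr fun i hi => ?_
        rw [(hx _ (mul_add_lt_mul hi u.2)).1, (hx _ (mul_add_lt_mul hi u.2)).2,
          (hx _ (mul_add_lt_mul hi v.2)).1, (hx _ (mul_add_lt_mul hi v.2)).2]
      -- The stored representation is optimal, so a positive factor suffices.
      · have := one_le_ceil_box hn
        exact Nat.le_mul_of_pos_left _ (by omega)
    · obtain ⟨h0, hx⟩ := h₂ hnN
      have hn2 : 2 ≤ (⟨n, G⟩ : Dat).1 := by change 2 ≤ n; omega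
      have hcell : ∀ i < boxDim ⟨n, G⟩, ∀ v < n,
          s.arr 1 (i * n + v) = boxCell boxLeft ⟨n, G⟩ i v ∧
          s.arr 2 (i * n + v) = boxCell boxRight ⟨n, G⟩ i v := fun i hi v hv => by
        have := hx _ (mul_add_lt_mul hi hv)
        simpa only [mul_add_div_of_lt hv, mul_add_mod_of_lt hv] using this
      refine ⟨s, t, boxDim ⟨n, G⟩, h, ht, holdsBoxRepresentation_of h0 (fun i hi v hv => ?_)
        (fun u v => ?_), fun _ => ?_⟩
      · rw [(hcell i hi v hv).1, (hcell i hi v hv).2]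
        exact boxCell_left_le_right hn2 hi hv
      · rw [← adj_val_iff, adj_iff_boxCell hn2 u.2 v.2, ne_eq, Fin.val_inj]
        refine and_congr_right fun _ => forall₂_congr fun i hi => ?_
        rw [(hcell i hi u u.2).1, (hcell i hi u u.2).2, (hcell i hi v v.2).1,
          (hcell i hi v v.2).2]
      · calc numBlocks n * numFamilies ⟨n, G⟩ * 2 = 2 * numBlocks n * numFamilies ⟨n, G⟩ := by ring
          _ ≤ _ := Nat.mul_le_mul (Nat.mul_le_mul_left 2 (numBlocks_le_ceil (hN n hnN)))
            (numFamilies_le_box ⟨n, G⟩ hn2)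
  · choose X₀ K₀ hK₀ h₀ using fun D : Dat => exists_nat_cubes D.2
    obtain ⟨p, T, hp⟩ := exists_exec_table N (fun D => cub D.2) X₀ (fun D _ => K₀ D) pc_cubeDim
      pc_cubeCell (((PC.const 2).mul pc_blockSize).add (PC.const 1))
    refine ⟨p, T, fun n G => ?_⟩
    obtain ⟨s, t, h, ht, h₁, h₂⟩ := hp ⟨n, G⟩
    have hlt : ∀ {d i : ℕ}, i < d → i < d * (n + 1) := fun hi =>
      hi.trans_le (Nat.le_mul_of_pos_right _ n.succ_pos)
    rcases lt_or_ge n N with hnN | hnN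
    · obtain ⟨h0, hx⟩ := h₁ hnN
      refine ⟨s, t, cub G, h, ht, holdsCubeRepresentation_of h0 (fun i hi => ?_)
        (fun u v => ?_), fun hn => ?_⟩
      · rw [(hx i (hlt hi)).2]
        exact hK₀ ⟨n, G⟩
      · rw [h₀ ⟨n, G⟩ u v]
        refine and_congr_right fun _ => forall₂_congr fun i hi => ?_
        rw [(hx _ (mul_add_lt_mul hi u.2)).1, (hx _ (mul_add_lt_mul hi v.2)).1, (hx i (hlt hi)).2]
      · have := one_le_ceil_cub hn
        exact Nat.le_mul_of_pos_left _ (by omega)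
    · obtain ⟨h0, hx⟩ := h₂ hnN
      have hn2 : 2 ≤ (⟨n, G⟩ : Dat).1 := by change 2 ≤ n; omega
      have hcell : ∀ i < cubeDim ⟨n, G⟩, ∀ v < n,
          s.arr 1 (i * n + v) = cubeCell ⟨n, G⟩ i v := fun i hi v hv => by
        have := (hx _ (mul_add_lt_mul hi hv)).1
        simpa only [mul_add_div_of_lt hv, mul_add_mod_of_lt hv] using this
      have hden : ∀ i < cubeDim ⟨n, G⟩, s.arr 2 i = 2 * blockSize n + 1 := fun i hi =>
        (hx i (hlt hi)).2
      refine ⟨s, t, cubeDim ⟨n, G⟩, h, ht, holdsCubeRepresentation_of h0 (fun i hi => ?_)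
        (fun u v => ?_), fun _ => ?_⟩
      · rw [hden i hi]
        exact Nat.succ_pos _
      · rw [← adj_val_iff, adj_iff_cubeCell hn2 u.2 v.2, ne_eq, Fin.val_inj]
        refine and_congr_right fun _ => forall₂_congr fun i hi => ?_
        rw [hcell i hi u u.2, hcell i hi v v.2, hden i hi]
      · calc numBlocks n * numFamilies ⟨n, G⟩ * numBits n * 2
            = 2 * (numBlocks n * numBits n) * numFamilies ⟨n, G⟩ := by ring
          _ ≤ _ := Nat.mul_le_mul
            (Nat.mul_le_mul_left 2 (numBlocks_mul_numBits_le_ceil (hN n hnN)))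
            ((numFamilies_le_box ⟨n, G⟩ hn2).trans (box_le_cub G))
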